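/- A triangulation is a finite collection of tetrahedra $i(0123)$ some or all of whose faces are affinely glued in pairs, such that no face is glued to itself and no edge is identified with itself in reverse; $i(abc)\mapsto j(def)$ denotes the gluing of face $abc$ of tetrahedron $i$ to face $def$ of tetrahedron $j$ with $a\mapsto d$, $b\mapsto e$, $c\mapsto f$. It is closed if every face is glued, and 1-vertex if all tetrahedron vertices are identified. A normal surface is given by its normal coordinates, a vector of $7n$ non-negative integers (four triangle and three quadrilateral counts per tetrahedron) that satisfies the matching equations and has at most one non-zero quadrilateral count per tetrahedron; it is a vertex normal surface if it is non-zero, spans an extremal ray of the cone of all non-negative real solutions of the matching equations, and is the smallest non-zero integer point on this ray. For $m\ge 1$ let $\mathcal B_m$ be the layered solid torus $\mathrm{LST}(F_{m+1},F_{m+2},F_{m+3})$ with $m$ tetrahedra $0,\dots,m-1$ and gluings $0(023)\mapsto 0(231)$, $(i+1)(023)\mapsto i(120)$ and $(i+1)(123)\mapsto i(013)$ for $0\le i<m-1$. Let $\mathcal E$ be the triangulation with four tetrahedra and gluings $$\begin{array}{c|cccc} i & i(012) & i(013) & i(023) & i(123)\\ \hline 0&2(231)&1(230)&2(023)&1(123)\\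 1&3(012)&2(102)&0(301)&0(123)\\ 2&1(103)&3(230)&0(023)&0(201)\\ 3&1(012)&\partial&2(301)&\partial\end{array}$$ where $\partial$ marks the two boundary faces. Theorem. There is a family $(\mathcal C_n)_{n\ge 5}$ such that for each $n\ge 5$: $\mathcal C_n$ is a closed 1-vertex triangulation with $n$ tetrahedra of a closed 3-manifold (all vertex links are spheres), it is obtained by gluing $\mathcal B_{n-4}$ and $\mathcal E$ along their boundaries by an isomorphism of the boundary complexes, and it contains a vertex normal surface which - if $n\equiv 2 \pmod 3$, is a projective plane with maximum normal coordinate at least $F_{n-3}$; - if $n\not\equiv 2 \pmod 3$, is a sphere with maximum normal coordinate at least $2F_{n-3}$. Here $F_k$ is the $k$-th Fibonacci number ($F_0=0$, $F_1=1$). -/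

import Mathlib

namespace NormalSurf

/-! ### Generalised triangulations -/

/-- Raw face gluings of a family of tetrahedra `ι`, each with vertices `0, 1, 2, 3`; face `f` of a
tetrahedron is the triangle opposite vertex `f`.  `g t f = none` says that face `f` of `t` is a
boundary face.  `g t f = some (u, σ)` says that it is glued to face `σ f` of `u`, each
vertex `v ≠ f` of the face going to vertex `σ v` of `u`. -/
abbrev Gluing (ι : Type*) := ι → Fin 4 → Option (ι × Equiv.Perm (Fin 4))

variable {ι κ lam : Type*}

/-- The oriented edge `a → b` of tetrahedron `t` is carried to `a' → b'` of `t'` by the gluing of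
one face containing it. Oriented edges are triples `(t, a, b)` with `a ≠ b`. -/
def EdgeStep (g : Gluing ι) (p q : ι × Fin 4 × Fin 4) : Prop :=
  p.2.1 ≠ p.2.2 ∧ ∃ (f : Fin 4) (σ : Equiv.Perm (Fin 4)), p.2.1 ≠ f ∧ p.2.2 ≠ f ∧
    g p.1 f = some (q.1, σ) ∧ q.2.1 = σ p.2.1 ∧ q.2.2 = σ p.2.2

/-- Identification of oriented edges generated by the gluings. -/
def EdgeRel (g : Gluing ι) : ι × Fin 4 × Fin 4 → ι × Fin 4 × Fin 4 → Prop :=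
  Relation.EqvGen (EdgeStep g)

/-- A (generalised) triangulation: faces are glued in pairs, no face to itself, and no
edge is identified with itself in reverse. -/
structure Triangulation (ι : Type*) where
  glue : Gluing ι
  glue_symm : ∀ t f u σ, glue t f = some (u, σ) → glue u (σ f) = some (t, σ.symm)
  glue_ne : ∀ t f u σ, glue t f = some (u, σ) → ¬ (u = t ∧ σ f = f)
  no_reverse : ∀ t a b, a ≠ b → ¬ EdgeRel glue (t, a, b) (t, b, a)

/-- An antisymmetric nonzero invariant of oriented edges excludes reversed edges. -/
theorem no_reverse_of_label (g : Gluing ι) (L : ι → Fin 4 → Fin 4 → ℤ)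
    (hL : ∀ t a b, a ≠ b → L t a b ≠ 0 ∧ L t b a = - L t a b)
    (hg : ∀ t f u σ, g t f = some (u, σ) → ∀ a b, a ≠ b → a ≠ f → b ≠ f →
      L u (σ a) (σ b) = L t a b) :
    ∀ t a b, a ≠ b → ¬ EdgeRel g (t, a, b) (t, b, a) := by
  have key : ∀ p q, EdgeRel g p q → L p.1 p.2.1 p.2.2 = L q.1 q.2.1 q.2.2 := by
    intro p q h
    induction h with
    | rel p q h =>
      obtain ⟨hne, f, σ, h1, h2, h3, h4, h5⟩ := h
      rw [h4, h5]
      exact (hg _ _ _ _ h3 _ _ hne h1 h2).symm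
    | refl p => rfl
    | symm p q _ ih => exact ih.symm
    | trans p q r _ _ ih1 ih2 => exact ih1.trans ih2
  intro t a b hab h
  have h1 := key _ _ h
  have h2 := hL t a b hab
  simp only at h1
  omega

namespace Triangulation

/-- No boundary faces. -/
def IsClosed (T : Triangulation ι) : Prop := ∀ t f, T.glue t f ≠ none

/-- Vertex `v` of `t` is carried to vertex `v'` of `t'` by the gluing of a face containing it. -/
def VertexStep (T : Triangulation ι) (p q : ι × Fin 4) : Prop :=
  ∃ (f : Fin 4) (σ : Equiv.Perm (Fin 4)), p.2 ≠ f ∧ T.glue p.1 f = some (q.1, σ) ∧ q.2 = σ p.2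

/-- Identification of tetrahedron vertices generated by the gluings. -/
def VertexRel (T : Triangulation ι) : ι × Fin 4 → ι × Fin 4 → Prop :=
  Relation.EqvGen T.VertexStep

/-- There is exactly one vertex. -/
def IsOneVertex (T : Triangulation ι) : Prop :=
  Nonempty ι ∧ ∀ p q, T.VertexRel p q

/-- `T` is obtained from `T₁` and `T₂` by gluing them along their entire boundaries: up to a
relabelling `e` of tetrahedra, `T` keeps all gluings of `T₁` and `T₂`, each boundary face of one is
glued to a boundary face of the other, and the resulting bijection of boundary faces is an
isomorphism of the boundary complexes (two oriented edges of boundary faces are identified in `T₁`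
iff their images are identified in `T₂`). -/
def IsBoundaryUnion (T₁ : Triangulation ι) (T₂ : Triangulation κ) (T : Triangulation lam) : Prop :=
  ∃ e : ι ⊕ κ ≃ lam,
    (∀ t f u σ, T₁.glue t f = some (u, σ) →
      T.glue (e (.inl t)) f = some (e (.inl u), σ)) ∧
    (∀ t f u σ, T₂.glue t f = some (u, σ) →
      T.glue (e (.inr t)) f = some (e (.inr u), σ)) ∧
    (∀ t f, T₁.glue t f = none → ∃ u σ, T₂.glue u (σ f) = none ∧
      T.glue (e (.inl t)) f = some (e (.inr u), σ)) ∧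
    (∀ t f, T₂.glue t f = none → ∃ u σ, T₁.glue u (σ f) = none ∧
      T.glue (e (.inr t)) f = some (e (.inl u), σ)) ∧
    (∀ t f u σ t' f' u' σ', T₁.glue t f = none → T₁.glue t' f' = none →
      T.glue (e (.inl t)) f = some (e (.inr u), σ) →
      T.glue (e (.inl t')) f' = some (e (.inr u'), σ') →
      ∀ a b a' b', a ≠ b → a ≠ f → b ≠ f → a' ≠ b' → a' ≠ f' → b' ≠ f' →
        (EdgeRel T₁.glue (t, a, b) (t', a', b') ↔
          EdgeRel T₂.glue (u, σ a, σ b) (u', σ' a', σ' b')))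

end Triangulation

/-! ### Normal coordinates -/

/-- The seven types of normal pieces: `inl v` is the triangle cutting off vertex `v`; `inr q` is the
quadrilateral separating `{0, q + 1}` from the two other vertices. -/
abbrev Disc := Fin 4 ⊕ Fin 3

/-- The quadrilateral type separating `{a, b}` from the other two vertices (for `a ≠ b`; the
diagonal values are irrelevant). -/
def quadOf (a b : Fin 4) : Fin 3 :=
  ![![0, 0, 1, 2], ![0, 0, 2, 1], ![1, 2, 0, 0], ![2, 1, 0, 0]] a b

/-- Number of normal arcs in face `f` cutting off the vertex `v ≠ f` of that face. -/
def arcCount {R : Type*} [Add R] (y : Disc → R) (f v : Fin 4) : R :=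
  y (.inl v) + y (.inr (quadOf v f))

/-- Number of intersection points with the edge `ab`, `a ≠ b`. -/
def edgeWeight (y : Disc → ℕ) (a b : Fin 4) : ℕ :=
  y (.inl a) + y (.inl b) + ∑ q ∈ Finset.univ.filter (fun q : Fin 3 => q ≠ quadOf a b), y (.inr q)

/-- The pieces of the normal surface with coordinates `x`.  The triangles of type `v` in `t` are
numbered starting from the one closest to `v`, the quadrilaterals starting from the one closest to
vertex `0`. -/
abbrev Piece (x : ι → Disc → ℕ) := Σ (t : ι) (d : Disc), Fin (x t d)

/-- Intersection points of the surface with tetrahedron edges: the `k`-th point, counted from `a`,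
on the edge from `a` to `b` of `t`. -/
structure EdgePoint (x : ι → Disc → ℕ) where
  tet : ι
  a : Fin 4
  b : Fin 4
  k : ℕ
  ne : a ≠ b
  lt : k < edgeWeight (x tet) a b

/-- Normal arcs of the surface in tetrahedron faces: the `k`-th arc, counted from `v`, cutting off
vertex `v` in face `f` of `t`. -/
structure FaceArc (x : ι → Disc → ℕ) where
  tet : ι
  f : Fin 4
  v : Fin 4
  k : ℕ
  ne : v ≠ f
  lt : k < arcCount (x tet) f v

/-- The arc `α` is a side of the piece `p`.  Counting from `v`, the arcs cutting off `v` in face `f`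
are those of the triangles at `v` followed by those of the quadrilaterals separating
`{v, f}` from the other vertices. -/
def IsSide (x : ι → Disc → ℕ) (p : Piece x) (α : FaceArc x) : Prop :=
  α.tet = p.1 ∧
    match p with
    | ⟨_, .inl w, j⟩ => α.v = w ∧ α.k = j
    | ⟨t, .inr q, j⟩ => quadOf α.v α.f = q ∧
        α.k = x t (.inl α.v) +
          if α.v = 0 ∨ α.v = q.succ then (j : ℕ) else x t (.inr q) - 1 - (j : ℕ)

namespace Triangulation

variable (T : Triangulation ι)

/-- The matching equations, one for each arc type of each internal face. -/
def Matching {R : Type*} [Add R] (y : ι → Disc → R) : Prop :=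
  ∀ t f u σ, T.glue t f = some (u, σ) → ∀ v, v ≠ f →
    arcCount (y t) f v = arcCount (y u) (σ f) (σ v)

/-- `x` is the vector of normal coordinates of a normal surface: non-negative integers satisfying
the matching equations and the quadrilateral constraints (at most one type of quadrilateral occurs
in each tetrahedron). -/
def IsNormal (x : ι → Disc → ℕ) : Prop :=
  T.Matching x ∧ ∀ t q q', x t (.inr q) ≠ 0 → x t (.inr q') ≠ 0 → q = q'

/-- The cone of non-negative real solutions of the matching equations. -/
def solutionCone : Set (ι → Disc → ℝ) :=
  {y | (∀ t d, 0 ≤ y t d) ∧ T.Matching y}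

/-- A normal coordinate vector as a real vector. -/
def toReal (x : ι → Disc → ℕ) : ι → Disc → ℝ := fun t d => (x t d : ℝ)

/-- The ray from the origin through `y`. -/
def ray (y : ι → Disc → ℝ) : Set (ι → Disc → ℝ) := {z | ∃ c : ℝ, 0 ≤ c ∧ z = c • y}

/-- `x` is a vertex normal surface: a nonzero normal surface that spans an extremal ray of the
solution cone and is the smallest nonzero integer point of this ray. -/
def IsVertexNormal (x : ι → Disc → ℕ) : Prop :=
  T.IsNormal x ∧ x ≠ 0 ∧ IsExtreme ℝ T.solutionCone (ray (toReal x)) ∧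
    ∀ z : ι → Disc → ℕ, z ≠ 0 → toReal z ∈ ray (toReal x) → x ≤ z

/-- Identification of the edge points of a normal surface, by reading an edge in the opposite
direction and by the face gluings; its quotient is the set of vertices of the surface. -/
def PointStep (x : ι → Disc → ℕ) (p q : EdgePoint x) : Prop :=
  (q.tet = p.tet ∧ q.a = p.b ∧ q.b = p.a ∧ q.k + p.k + 1 = edgeWeight (x p.tet) p.a p.b) ∨
  ∃ (f : Fin 4) (σ : Equiv.Perm (Fin 4)), p.a ≠ f ∧ p.b ≠ f ∧
    T.glue p.tet f = some (q.tet, σ) ∧ q.a = σ p.a ∧ q.b = σ p.b ∧ q.k = p.k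

/-- Identification of the normal arcs of a normal surface by the face gluings; its quotient is
the set of edges of the surface. -/
def ArcStep (x : ι → Disc → ℕ) (α β : FaceArc x) : Prop :=
  ∃ σ : Equiv.Perm (Fin 4), T.glue α.tet α.f = some (β.tet, σ) ∧
    β.f = σ α.f ∧ β.v = σ α.v ∧ β.k = α.k

/-- Euler characteristic (vertices minus edges plus faces) of the normal surface `x` with its cell
structure by normal pieces. -/
noncomputable def eulerChar (x : ι → Disc → ℕ) : ℤ :=
  (Nat.card (Quot (T.PointStep x)) : ℤ) - Nat.card (Quot (T.ArcStep x)) + Nat.card (Piece x)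

/-- Two pieces of a normal surface have sides that are glued together. -/
def PieceAdj (x : ι → Disc → ℕ) (p q : Piece x) : Prop :=
  ∃ α β : FaceArc x, IsSide x p α ∧ IsSide x q β ∧ T.ArcStep x α β

/-- `x` is a non-empty connected normal surface without boundary. -/
def IsClosedConnectedSurface (x : ι → Disc → ℕ) : Prop :=
  T.IsNormal x ∧ (∀ t f v, T.glue t f = none → v ≠ f → arcCount (x t) f v = 0) ∧
    Nonempty (Piece x) ∧ ∀ p q : Piece x, Relation.EqvGen (T.PieceAdj x) p q

/-- The normal surface `x` is a sphere: the closed connected surface of Euler characteristic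
`2`. -/
def IsSphere (x : ι → Disc → ℕ) : Prop :=
  T.IsClosedConnectedSurface x ∧ T.eulerChar x = 2

/-- The normal surface `x` is a projective plane: the closed connected surface of Euler
characteristic `1`. -/
def IsProjectivePlane (x : ι → Disc → ℕ) : Prop :=
  T.IsClosedConnectedSurface x ∧ T.eulerChar x = 1

open Classical in
/-- The link of the vertex represented by `v` in `t`: one normal triangle at every tetrahedron
vertex that is identified with it. -/
noncomputable def vertexLink (t : ι) (v : Fin 4) : ι → Disc → ℕ := fun u d =>
  match d with
  | .inl w => if T.VertexRel (t, v) (u, w) then 1 else 0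
  | .inr _ => 0

/-- `T` triangulates a closed 3-manifold: there is no boundary and each vertex link is a sphere. -/
def IsClosedManifold : Prop :=
  T.IsClosed ∧ ∀ t v, T.IsSphere (T.vertexLink t v)

/-- The maximum coordinate. -/
def maxCoord [Fintype ι] (x : ι → Disc → ℕ) : ℕ :=
  Finset.univ.sup fun p : ι × Disc => x p.1 p.2

end Triangulation

/-! ### The layered solid tori and the plug -/

/-- The permutation with value list `f` and inverse `g`. -/
def mkPerm (f g : Fin 4 → Fin 4) (h₁ : Function.LeftInverse g f := by decide)
    (h₂ : Function.RightInverse g f := by decide) : Equiv.Perm (Fin 4) := ⟨f, g, h₁, h₂⟩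

/-- `(023) ↦ (231)` -/
def foldPerm : Equiv.Perm (Fin 4) := mkPerm ![2, 0, 3, 1] ![1, 3, 0, 2]
/-- `(023) ↦ (120)` -/
def layerPerm₁ : Equiv.Perm (Fin 4) := mkPerm ![1, 3, 2, 0] ![3, 0, 2, 1]
/-- `(123) ↦ (013)` -/
def layerPerm₀ : Equiv.Perm (Fin 4) := mkPerm ![2, 0, 1, 3] ![1, 2, 0, 3]

/-- Gluings of the layered solid torus with `m` tetrahedra: tetrahedron `0` is the one-tetrahedron
solid torus `LST(1,2,3)`, with its faces `(023)` and `(231)` glued; for each `i`, tetrahedron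
`i + 1` is layered on the boundary faces `(012)` and `(013)` of tetrahedron `i` by
`(i+1)(023) ↦ i(120)` and `(i+1)(123) ↦ i(013)`.  This covers the boundary edge
that meets the meridian disc in the fewest points. -/
def layeredGlue (m : ℕ) : Gluing (Fin m) := fun i =>
  ![if (i : ℕ) = 0 then some (i, foldPerm.symm)
      else some (⟨i - 1, (Nat.sub_le _ _).trans_lt i.2⟩, layerPerm₀),
    if (i : ℕ) = 0 then some (i, foldPerm)
      else some (⟨i - 1, (Nat.sub_le _ _).trans_lt i.2⟩, layerPerm₁),
    if h : (i : ℕ) + 1 < m then some (⟨i + 1, h⟩, layerPerm₀.symm) else none,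
    if h : (i : ℕ) + 1 < m then some (⟨i + 1, h⟩, layerPerm₁.symm) else none]

/-- A label of the oriented edges of the layered solid torus, by edge class and direction. -/
def layeredLabel (k : ℕ) : Fin 4 → Fin 4 → ℤ :=
  ![![0, (k + 4 : ℤ), (k + 2 : ℤ), (k + 3 : ℤ)],
    ![-(k + 4 : ℤ), 0, -(k + 3 : ℤ), -(k + 2 : ℤ)],
    ![-(k + 2 : ℤ), (k + 3 : ℤ), 0, (if k = 0 then 2 else k + 1 : ℤ)],
    ![-(k + 3 : ℤ), (k + 2 : ℤ), -(if k = 0 then 2 else k + 1 : ℤ), 0]]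

theorem layeredGlue_eq_some (m : ℕ) (t : Fin m) (f : Fin 4) (u : Fin m)
    (σ : Equiv.Perm (Fin 4)) : layeredGlue m t f = some (u, σ) ↔
      (f = 0 ∧ (t : ℕ) = 0 ∧ (u : ℕ) = 0 ∧ σ = foldPerm.symm) ∨
      (f = 1 ∧ (t : ℕ) = 0 ∧ (u : ℕ) = 0 ∧ σ = foldPerm) ∨
      (f = 0 ∧ (t : ℕ) = u + 1 ∧ σ = layerPerm₀) ∨
      (f = 1 ∧ (t : ℕ) = u + 1 ∧ σ = layerPerm₁) ∨
      (f = 2 ∧ (u : ℕ) = t + 1 ∧ σ = layerPerm₀.symm) ∨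
      (f = 3 ∧ (u : ℕ) = t + 1 ∧ σ = layerPerm₁.symm) := by
  obtain ⟨t, ht⟩ := t
  obtain ⟨u, hu⟩ := u
  fin_cases f <;> simp [layeredGlue] <;> grind

theorem layeredGlue_symm (m : ℕ) (t : Fin m) (f : Fin 4) (u : Fin m) (σ : Equiv.Perm (Fin 4))
    (h : layeredGlue m t f = some (u, σ)) : layeredGlue m u (σ f) = some (t, σ.symm) := by
  rw [layeredGlue_eq_some] at h ⊢
  rcases h with ⟨rfl, h1, h2, rfl⟩ | ⟨rfl, h1, h2, rfl⟩ | ⟨rfl, h, rfl⟩ | ⟨rfl, h, rfl⟩ |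
    ⟨rfl, h, rfl⟩ | ⟨rfl, h, rfl⟩ <;>
  simp [*, foldPerm, layerPerm₀, layerPerm₁, mkPerm]

theorem layeredGlue_ne (m : ℕ) (t : Fin m) (f : Fin 4) (u : Fin m) (σ : Equiv.Perm (Fin 4))
    (h : layeredGlue m t f = some (u, σ)) : ¬ (u = t ∧ σ f = f) := by
  rw [layeredGlue_eq_some] at h
  rw [Fin.ext_iff]
  rcases h with ⟨rfl, h1, h2, rfl⟩ | ⟨rfl, h1, h2, rfl⟩ | ⟨rfl, h, rfl⟩ | ⟨rfl, h, rfl⟩ |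
    ⟨rfl, h, rfl⟩ | ⟨rfl, h, rfl⟩ <;>
  simp [*, foldPerm, layerPerm₀, layerPerm₁, mkPerm]

theorem layeredGlue_label (m : ℕ) (t : Fin m) (f : Fin 4) (u : Fin m) (σ : Equiv.Perm (Fin 4))
    (h : layeredGlue m t f = some (u, σ)) (a b : Fin 4) (hab : a ≠ b) (ha : a ≠ f) (hb : b ≠ f) :
    (-1) ^ (u : ℕ) * layeredLabel u (σ a) (σ b) = (-1) ^ (t : ℕ) * layeredLabel t a b := by
  rw [layeredGlue_eq_some] at h
  rcases h with ⟨rfl, h1, h2, rfl⟩ | ⟨rfl, h1, h2, rfl⟩ | ⟨rfl, h, rfl⟩ | ⟨rfl, h, rfl⟩ |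
    ⟨rfl, h, rfl⟩ | ⟨rfl, h, rfl⟩ <;>
  fin_cases a <;> fin_cases b <;>
  simp [*, foldPerm, layerPerm₀, layerPerm₁, mkPerm, layeredLabel, pow_succ] at hab ha hb ⊢ <;>
  ring

/-- The layered solid torus `LST(F_{m+1}, F_{m+2}, F_{m+3})` with `m` tetrahedra. -/
def layeredSolidTorus (m : ℕ) : Triangulation (Fin m) where
  glue := layeredGlue m
  glue_symm := layeredGlue_symm m
  glue_ne := layeredGlue_ne m
  no_reverse := no_reverse_of_label _ (fun t a b => (-1) ^ (t : ℕ) * layeredLabel t a b)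
    (by
      rintro ⟨t, ht⟩ a b hab
      refine ⟨mul_ne_zero (pow_ne_zero _ (by norm_num)) ?_, ?_⟩
      · fin_cases a <;> fin_cases b <;> simp [layeredLabel] at hab ⊢ <;> (try split_ifs) <;> omega
      · rw [← mul_neg]
        congr 1
        fin_cases a <;> fin_cases b <;> simp [layeredLabel] at hab ⊢)
    (layeredGlue_label m)

/-- `(012) ↦ (231)`, `(013) ↦ (230)` -/
def plugPerm₁ : Equiv.Perm (Fin 4) := mkPerm ![2, 3, 1, 0] ![3, 2, 0, 1]
/-- `(013) ↦ (102)` -/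
def plugPerm₂ : Equiv.Perm (Fin 4) := mkPerm ![1, 0, 3, 2] ![1, 0, 3, 2]

/-- Gluings of the four-tetrahedron plug:
```
     i(012)   i(013)   i(023)   i(123)
 0   2(231)   1(230)   2(023)   1(123)
 1   3(012)   2(102)   0(301)   0(123)
 2   1(103)   3(230)   0(023)   0(201)
 3   1(012)     ∂      2(301)     ∂
```
In the rows below the faces are listed in the order `(123), (023), (013), (012)`. -/
def plugGlue : Gluing (Fin 4) :=
  ![![some (1, 1), some (2, 1), some (1, plugPerm₁), some (2, plugPerm₁)],
    ![some (0, 1), some (0, plugPerm₁.symm), some (2, plugPerm₂), some (3, 1)],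
    ![some (0, plugPerm₁.symm), some (0, 1), some (3, plugPerm₁), some (1, plugPerm₂)],
    ![none, some (2, plugPerm₁.symm), none, some (1, 1)]]

/-- A label of the oriented edges of the plug, by edge class and direction. -/
def plugLabel : Fin 4 → Fin 4 → Fin 4 → ℤ :=
  ![![![0, 1, 2, 3], ![-1, 0, 4, 2], ![-2, -4, 0, 1], ![-3, -2, -1, 0]],
    ![![0, 5, -3, -2], ![-5, 0, 4, 2], ![3, -4, 0, 1], ![2, -2, -1, 0]],
    ![![0, -5, 2, 3], ![5, 0, -2, -4], ![-2, 2, 0, 1], ![-3, 4, -1, 0]],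
    ![![0, 5, -3, 4], ![-5, 0, 4, 6], ![3, -4, 0, -5], ![-4, -6, 5, 0]]]

theorem plugGlue_spec (t f : Fin 4) : ∀ p ∈ plugGlue t f,
    plugGlue p.1 (p.2 f) = some (t, p.2.symm) ∧ ¬ (p.1 = t ∧ p.2 f = f) ∧
    ∀ a b, a ≠ b → a ≠ f → b ≠ f → plugLabel p.1 (p.2 a) (p.2 b) = plugLabel t a b := by
  fin_cases t <;> fin_cases f <;> simp [plugGlue] <;> decide

/-- The four-tetrahedron plug. -/
def plug : Triangulation (Fin 4) where
  glue := plugGlue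
  glue_symm t f u σ h := (plugGlue_spec t f (u, σ) h).1
  glue_ne t f u σ h := (plugGlue_spec t f (u, σ) h).2.1
  no_reverse := no_reverse_of_label _ plugLabel (by decide)
    (fun t f u σ h => (plugGlue_spec t f (u, σ) h).2.2)

end NormalSurf

/-!
Close the layered solid torus with the plug. The coordinates of a meridian disc of the layered
solid torus are Fibonacci numbers, and the boundary of `s` copies of it can be capped off in the
plug by a surface with one parameter `p` if and only if `2 * p = s * F_{m+3}`. The solutions of the
matching equations with the resulting support form a ray, and its smallest integer point has `s = 1`
if `F_{m+3}` is even, that is if `3 ∣ m + 3`, and `s = 2` otherwise. The Euler characteristic of the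
surface is `s`. It is connected, as any vertex normal surface is: the pieces of a component satisfy
the matching equations on their own, so their coordinate vector lies on the same extremal ray, on
which the surface itself is the smallest integer point.

Edge classes are counted by integer labels of the oriented edges that are invariant under the
gluings and change sign with the orientation: edges whose labels differ in absolute value are not
identified. In a closed triangulation with one vertex, `n` tetrahedra and `n + 1` edges, the vertex
link has Euler characteristic `2 * (n + 1) - 6 * n + 4 * n = 2`.
-/

namespace NormalSurf

variable {ι κ lam κ₁ κ₂ κ' : Type*}

/-! ### Edges -/

theorem eqvGen_map {α β : Type*} {r : α → α → Prop} {s : β → β → Prop} (φ : α → β)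
    (hφ : ∀ a b, r a b → Relation.EqvGen s (φ a) (φ b)) {a b : α} (h : Relation.EqvGen r a b) :
    Relation.EqvGen s (φ a) (φ b) :=
  Quot.eqvGen_exact <| congrArg
    (Quot.lift (fun a => Quot.mk s (φ a)) fun a b h => Quot.eqvGen_sound (hφ a b h))
    (Quot.eqvGen_sound h)

namespace EdgeRel

variable {g : Gluing ι}

theorem of_glue {t u : ι} {f a b : Fin 4} {σ : Equiv.Perm (Fin 4)} (h : g t f = some (u, σ))
    (hab : a ≠ b) (ha : a ≠ f) (hb : b ≠ f) : EdgeRel g (t, a, b) (u, σ a, σ b) :=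
  .rel _ _ ⟨hab, f, σ, ha, hb, h, rfl, rfl⟩

theorem symm {p q : ι × Fin 4 × Fin 4} (h : EdgeRel g p q) : EdgeRel g q p :=
  Relation.EqvGen.symm _ _ h

theorem trans {p q r : ι × Fin 4 × Fin 4} (h : EdgeRel g p q) (h' : EdgeRel g q r) :
    EdgeRel g p r :=
  Relation.EqvGen.trans _ _ _ h h'

theorem apply_eq {α : Type*} (F : ι × Fin 4 × Fin 4 → α)
    (hF : ∀ t f u σ, g t f = some (u, σ) → ∀ a b, a ≠ b → a ≠ f → b ≠ f →
      F (u, σ a, σ b) = F (t, a, b)) {p q : ι × Fin 4 × Fin 4} (h : EdgeRel g p q) :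
    F p = F q := by
  refine congrArg (Quot.lift F ?_) (Quot.eqvGen_sound h)
  rintro ⟨t, a, b⟩ ⟨u, _, _⟩ ⟨hab, f, σ, ha, hb, h, rfl, rfl⟩
  exact (hF t f u σ h a b hab ha hb).symm

theorem map {g' : Gluing κ} (φ : ι × Fin 4 × Fin 4 → κ × Fin 4 × Fin 4)
    (hφ : ∀ t f u σ, g t f = some (u, σ) → ∀ a b, a ≠ b → a ≠ f → b ≠ f →
      EdgeRel g' (φ (t, a, b)) (φ (u, σ a, σ b))) {p q : ι × Fin 4 × Fin 4}
    (h : EdgeRel g p q) : EdgeRel g' (φ p) (φ q) := by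
  refine eqvGen_map φ ?_ h
  rintro ⟨t, a, b⟩ ⟨u, _, _⟩ ⟨hab, f, σ, ha, hb, h, rfl, rfl⟩
  exact hφ t f u σ h a b hab ha hb

theorem swap {p q : ι × Fin 4 × Fin 4} (h : EdgeRel g p q) :
    EdgeRel g (p.1, p.2.2, p.2.1) (q.1, q.2.2, q.2.1) :=
  h.map (fun p => (p.1, p.2.2, p.2.1)) fun _ _ _ _ h _ _ hab ha hb => of_glue h hab.symm hb ha

end EdgeRel

/-- A separating invariant of the oriented edges of a gluing: a nonzero integer for every oriented
edge, opposite for opposite orientations, together with one oriented edge `rep c` for each edge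
`c : κ` of the glued complex such that distinct edges have distinct labels even up to sign. -/
structure EdgeLabelling (g : Gluing ι) (κ : Type*) where
  label : ι → Fin 4 → Fin 4 → ℤ
  ne_zero : ∀ t a b, a ≠ b → label t a b ≠ 0
  swap : ∀ t a b, a ≠ b → label t b a = -label t a b
  step : ∀ t f u σ, g t f = some (u, σ) → ∀ a b, a ≠ b → a ≠ f → b ≠ f →
    label u (σ a) (σ b) = label t a b
  rep : κ → ι × Fin 4 × Fin 4
  rep_ne : ∀ c, (rep c).2.1 ≠ (rep c).2.2
  rep_injective : Function.Injective fun c => (label (rep c).1 (rep c).2.1 (rep c).2.2).natAbs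
  exists_rep : ∀ t a b, a ≠ b → ∃ c, EdgeRel g (t, a, b) (rep c) ∨ EdgeRel g (t, b, a) (rep c)

namespace EdgeLabelling

variable {g : Gluing ι} (E : EdgeLabelling g κ)

theorem label_eq {p q : ι × Fin 4 × Fin 4} (h : EdgeRel g p q) :
    E.label p.1 p.2.1 p.2.2 = E.label q.1 q.2.1 q.2.2 :=
  h.apply_eq (fun p => E.label p.1 p.2.1 p.2.2) E.step

theorem edgeRel_iff {t t' : ι} {a b a' b' : Fin 4} (hab : a ≠ b) (hab' : a' ≠ b') :
    EdgeRel g (t, a, b) (t', a', b') ↔ E.label t a b = E.label t' a' b' := by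
  refine ⟨fun h => E.label_eq h, fun h => ?_⟩
  have hne : E.label t a b ≠ -E.label t' a' b' := by have := E.ne_zero t' a' b' hab'; omega
  obtain ⟨c, hc⟩ := E.exists_rep t a b hab
  obtain ⟨c', hc'⟩ := E.exists_rep t' a' b' hab'
  obtain rfl : c = c' := by
    apply E.rep_injective
    have hlab := hc.imp E.label_eq E.label_eq
    have hlab' := hc'.imp E.label_eq E.label_eq
    simp only [E.swap t a b hab, E.swap t' a' b' hab'] at hlab hlab'
    simp only
    omega
  rcases hc with hc | hc <;> rcases hc' with hc' | hc'
  · exact hc.trans hc'.symm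
  · exact absurd ((E.label_eq (hc.trans hc'.symm)).trans (E.swap t' a' b' hab')) hne
  · have := (E.label_eq (hc'.trans hc.symm)).trans (E.swap t a b hab)
    exact absurd (by simp only at this; omega) hne
  · exact (hc.trans hc'.symm).swap

end EdgeLabelling

theorem edgeWeight_comm (y : Disc → ℕ) (a b : Fin 4) : edgeWeight y b a = edgeWeight y a b := by
  have : quadOf b a = quadOf a b := by revert a b; decide
  rw [edgeWeight, edgeWeight, this, add_comm (y (.inl b))]

theorem edgeWeight_eq_arcCount_add_arcCount (y : Disc → ℕ) {f a b : Fin 4} (hab : a ≠ b)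
    (ha : a ≠ f) (hb : b ≠ f) : edgeWeight y a b = arcCount y f a + arcCount y f b := by
  have hfilter : Finset.univ.filter (fun q : Fin 3 => q ≠ quadOf a b) =
      {quadOf a f, quadOf b f} := by revert a b f; decide
  have hne : quadOf a f ≠ quadOf b f := by revert a b f; decide
  rw [edgeWeight, hfilter, Finset.sum_pair hne, arcCount, arcCount]
  ring

namespace Triangulation

variable {T : Triangulation ι}

theorem IsClosed.exists_glue (hT : T.IsClosed) (t : ι) (f : Fin 4) : ∃ p, T.glue t f = some p :=
  Option.ne_none_iff_exists'.1 (hT t f)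

theorem Matching.edgeWeight_glue {x : ι → Disc → ℕ} (hx : T.Matching x) {t u : ι} {f a b : Fin 4}
    {σ : Equiv.Perm (Fin 4)} (h : T.glue t f = some (u, σ)) (hab : a ≠ b) (ha : a ≠ f)
    (hb : b ≠ f) : edgeWeight (x u) (σ a) (σ b) = edgeWeight (x t) a b := by
  rw [edgeWeight_eq_arcCount_add_arcCount _ hab ha hb,
    edgeWeight_eq_arcCount_add_arcCount (f := σ f) _ (by simpa) (by simpa) (by simpa),
    hx t f u σ h a ha, hx t f u σ h b hb]

theorem Matching.edgeWeight_eq {x : ι → Disc → ℕ} (hx : T.Matching x) {p q : ι × Fin 4 × Fin 4}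
    (h : EdgeRel T.glue p q) :
    edgeWeight (x p.1) p.2.1 p.2.2 = edgeWeight (x q.1) q.2.1 q.2.2 :=
  h.apply_eq (fun p => edgeWeight (x p.1) p.2.1 p.2.2)
    fun _ _ _ _ h _ _ hab ha hb => hx.edgeWeight_glue h hab ha hb

/-! ### The Euler characteristic -/

theorem Matching.mk_point_eq {x : ι → Disc → ℕ} (hx : T.Matching x) {p q : ι × Fin 4 × Fin 4}
    (h : EdgeRel T.glue p q) {k : ℕ} (hp : p.2.1 ≠ p.2.2) (hq : q.2.1 ≠ q.2.2)
    (hkp : k < edgeWeight (x p.1) p.2.1 p.2.2) (hkq : k < edgeWeight (x q.1) q.2.1 q.2.2) :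
    Quot.mk (T.PointStep x) ⟨p.1, p.2.1, p.2.2, k, hp, hkp⟩ =
      Quot.mk (T.PointStep x) ⟨q.1, q.2.1, q.2.2, k, hq, hkq⟩ := by
  classical
  have := h.apply_eq (fun p => if h : p.2.1 ≠ p.2.2 ∧ k < edgeWeight (x p.1) p.2.1 p.2.2
    then some (Quot.mk (T.PointStep x) ⟨p.1, p.2.1, p.2.2, k, h.1, h.2⟩) else none) ?_
  · simpa [hp, hq, hkp, hkq] using this
  · intro t f u σ hg a b hab ha hb
    by_cases hk : k < edgeWeight (x t) a b
    · have hk' := (hx.edgeWeight_glue hg hab ha hb).symm ▸ hk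
      have hstep : T.PointStep x ⟨t, a, b, k, hab, hk⟩
          ⟨u, σ a, σ b, k, σ.injective.ne hab, hk'⟩ := Or.inr ⟨f, σ, ha, hb, hg, rfl, rfl, rfl⟩
      rw [dif_pos ⟨σ.injective.ne hab, hk'⟩, dif_pos ⟨hab, hk⟩]
      exact congrArg some (Quot.sound hstep).symm
    · rw [dif_neg, dif_neg]
      · exact fun h => hk h.2
      · exact fun h => hk (hx.edgeWeight_glue hg hab ha hb ▸ h.2)

theorem mk_point_swap {x : ι → Disc → ℕ} (p : EdgePoint x) :
    ∃ q : EdgePoint x, q.tet = p.tet ∧ q.a = p.b ∧ q.b = p.a ∧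
      Quot.mk (T.PointStep x) p = Quot.mk (T.PointStep x) q := by
  obtain ⟨t, a, b, k, hab, hk⟩ := p
  refine ⟨⟨t, b, a, edgeWeight (x t) a b - 1 - k, hab.symm, ?_⟩, rfl, rfl, rfl,
    Quot.sound (Or.inl ⟨rfl, rfl, rfl, ?_⟩)⟩
  · rw [edgeWeight_comm (x t) a b]
    omega
  · simp only
    omega

end Triangulation

namespace EdgeLabelling

open Triangulation

variable {T : Triangulation ι} (E : EdgeLabelling T.glue κ)

theorem exists_mk_rep {x : ι → Disc → ℕ} (hx : T.Matching x) (p : EdgePoint x) :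
    ∃ (c : κ) (k : ℕ) (hk : k < edgeWeight (x (E.rep c).1) (E.rep c).2.1 (E.rep c).2.2),
      Quot.mk (T.PointStep x) ⟨(E.rep c).1, (E.rep c).2.1, (E.rep c).2.2, k, E.rep_ne c, hk⟩ =
        Quot.mk (T.PointStep x) p := by
  have transport : ∀ (q : EdgePoint x) (c : κ), EdgeRel T.glue (q.tet, q.a, q.b) (E.rep c) →
      ∃ hk, Quot.mk (T.PointStep x)
        ⟨(E.rep c).1, (E.rep c).2.1, (E.rep c).2.2, q.k, E.rep_ne c, hk⟩ = Quot.mk _ q :=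
    fun q c h => ⟨hx.edgeWeight_eq h ▸ q.lt, (hx.mk_point_eq h q.ne (E.rep_ne c) q.lt _).symm⟩
  obtain ⟨c, hc | hc⟩ := E.exists_rep p.tet p.a p.b p.ne
  · exact ⟨c, p.k, transport p c hc⟩
  · obtain ⟨q, ht, ha, hb, hq⟩ := mk_point_swap (T := T) p
    rw [← ht, ← ha, ← hb] at hc
    exact ⟨c, q.k, hq ▸ transport q c hc⟩

/-- A complete invariant of the vertices of a normal surface: the edge on which the vertex lies, and
its signed position relative to the midpoint of that edge. -/
def pointCode (x : ι → Disc → ℕ) (p : EdgePoint x) : ℕ × ℤ :=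
  ((E.label p.tet p.a p.b).natAbs,
    E.label p.tet p.a p.b * (2 * p.k + 1 - edgeWeight (x p.tet) p.a p.b))

theorem pointCode_eq {x : ι → Disc → ℕ} (hx : T.Matching x) {p q : EdgePoint x}
    (h : T.PointStep x p q) : E.pointCode x p = E.pointCode x q := by
  obtain ⟨t, a, b, k, hab, hk⟩ := p
  obtain ⟨u, a', b', l, hab', hl⟩ := q
  obtain ⟨h₁, h₂, h₃, hkl⟩ | ⟨f, σ, ha, hb, hg, h₁, h₂, h₃⟩ := h
  · simp only at h₁ h₂ h₃ hkl
    subst h₁ h₂ h₃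
    simp only [pointCode, E.swap _ _ _ hab, Int.natAbs_neg, edgeWeight_comm _ a' b',
      Prod.mk.injEq, true_and]
    have : (l + k + 1 : ℤ) = edgeWeight (x u) a' b' := by
      rw [← edgeWeight_comm]
      exact_mod_cast hkl
    rw [← this]
    ring
  · simp only at ha hb hg h₁ h₂ h₃
    subst h₁ h₂ h₃
    simp only [pointCode, E.step _ _ _ _ hg _ _ hab ha hb, hx.edgeWeight_glue hg hab ha hb]

theorem natCard_point [Fintype κ] {x : ι → Disc → ℕ} (hx : T.Matching x) :
    Nat.card (Quot (T.PointStep x)) =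
      ∑ c, edgeWeight (x (E.rep c).1) (E.rep c).2.1 (E.rep c).2.2 := by
  let F : (Σ c, Fin (edgeWeight (x (E.rep c).1) (E.rep c).2.1 (E.rep c).2.2)) →
      Quot (T.PointStep x) := fun s =>
    Quot.mk _ ⟨(E.rep s.1).1, (E.rep s.1).2.1, (E.rep s.1).2.2, s.2, E.rep_ne s.1, s.2.2⟩
  have hF : Function.Bijective F := by
    constructor
    · rintro ⟨c, k⟩ ⟨c', k'⟩ h
      have hcode : E.pointCode x _ = E.pointCode x _ :=
        congrArg (Quot.lift (E.pointCode x) fun _ _ => E.pointCode_eq hx) h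
      obtain rfl : c = c' := E.rep_injective (congrArg Prod.fst hcode)
      have := mul_left_cancel₀ (E.ne_zero _ _ _ (E.rep_ne c)) (congrArg Prod.snd hcode)
      obtain rfl : k = k' := by
        ext
        simp only at this
        omega
      rfl
    · intro P
      obtain ⟨p, rfl⟩ := Quot.exists_rep P
      obtain ⟨c, k, hk, h⟩ := E.exists_mk_rep hx p
      exact ⟨⟨c, k, hk⟩, h⟩
  rw [← Nat.card_congr (Equiv.ofBijective F hF), Nat.card_sigma]
  simp only [Nat.card_eq_fintype_card, Fintype.card_fin]

end EdgeLabelling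

theorem natCard_piece [Fintype ι] (x : ι → Disc → ℕ) :
    Nat.card (Piece x) = ∑ t, ((∑ v, x t (.inl v)) + ∑ q, x t (.inr q)) := by
  simp [Piece, Nat.card_eq_fintype_card, Fintype.card_sigma]

/-- Normal arcs, sorted by tetrahedron, face and vertex. -/
def FaceArc.equivSigma (x : ι → Disc → ℕ) : FaceArc x ≃
    Σ (t : ι) (p : {p : Fin 4 × Fin 4 // p.2 ≠ p.1}), Fin (arcCount (x t) p.1.1 p.1.2) where
  toFun α := ⟨α.tet, ⟨(α.f, α.v), α.ne⟩, ⟨α.k, α.lt⟩⟩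
  invFun s := ⟨s.1, s.2.1.1.1, s.2.1.1.2, s.2.2, s.2.1.2, s.2.2.2⟩
  left_inv _ := rfl
  right_inv _ := rfl

instance [Finite ι] (x : ι → Disc → ℕ) : Finite (FaceArc x) :=
  Finite.of_equiv _ (FaceArc.equivSigma x).symm

theorem natCard_faceArc [Fintype ι] (x : ι → Disc → ℕ) :
    Nat.card (FaceArc x) = ∑ t, (3 * (∑ v, x t (.inl v)) + 4 * ∑ q, x t (.inr q)) := by
  rw [Nat.card_congr (FaceArc.equivSigma x), Nat.card_eq_fintype_card, Fintype.card_sigma]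
  refine Finset.sum_congr rfl fun t _ => ?_
  rw [Fintype.card_sigma]
  simp only [Fintype.card_fin]
  rw [← Finset.sum_subtype (Finset.univ.filter fun p : Fin 4 × Fin 4 => p.2 ≠ p.1) (by simp)
    (fun p => arcCount (x t) p.1 p.2), Finset.sum_filter, Fintype.sum_prod_type]
  simp [Fin.sum_univ_four, Fin.sum_univ_three, arcCount, quadOf]
  ring

theorem quot_mk_eq_iff_of_involutive {α : Type*} {r : α → α → Prop} {i : α → α}
    (hi : Function.Involutive i) (hr : ∀ a b, r a b ↔ b = i a) (a b : α) :
    Quot.mk r a = Quot.mk r b ↔ a = b ∨ a = i b := by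
  constructor
  · intro h
    replace h := Quot.eqvGen_exact h
    induction h with
    | rel a b h => exact Or.inr (by rw [(hr a b).1 h, hi])
    | refl => exact Or.inl rfl
    | symm a b _ ih => rcases ih with rfl | rfl <;> simp [hi _]
    | trans a b c _ _ ih₁ ih₂ =>
      rcases ih₁ with rfl | rfl <;> rcases ih₂ with rfl | rfl <;> simp [hi _]
  · rintro (rfl | rfl)
    · rfl
    · exact (Quot.sound ((hr _ _).2 rfl)).symm

theorem two_mul_natCard_quot_of_involutive {α : Type*} [Finite α] {r : α → α → Prop} {i : α → α}
    (hi : Function.Involutive i) (hne : ∀ a, i a ≠ a) (hr : ∀ a b, r a b ↔ b = i a) :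
    2 * Nat.card (Quot r) = Nat.card α := by
  have hfiber : ∀ c : Quot r, Nat.card {a // Quot.mk r a = c} = 2 := by
    intro c
    obtain ⟨a, rfl⟩ := Quot.exists_rep c
    have hset : {b | Quot.mk r b = Quot.mk r a} = {a, i a} := by
      ext b
      exact quot_mk_eq_iff_of_involutive hi hr b a
    rw [← Set.coe_ofPred, hset, Nat.card_coe_set_eq, Set.ncard_pair (hne a).symm]
  have := Fintype.ofFinite (Quot r)
  rw [← Nat.card_congr (Equiv.sigmaFiberEquiv (Quot.mk r)), Nat.card_sigma]
  simp [hfiber, mul_comm]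

namespace Triangulation

variable {T : Triangulation ι}

theorem two_mul_natCard_arc [Fintype ι] (hT : T.IsClosed) {x : ι → Disc → ℕ}
    (hx : T.Matching x) : 2 * Nat.card (Quot (T.ArcStep x)) =
      ∑ t, (3 * (∑ v, x t (.inl v)) + 4 * ∑ q, x t (.inr q)) := by
  rw [← natCard_faceArc]
  choose g hg using hT.exists_glue
  have hs : ∀ t f, g (g t f).1 ((g t f).2 f) = (t, (g t f).2.symm) := fun t f =>
    Option.some.inj ((hg _ _).symm.trans (T.glue_symm t f _ _ (hg t f)))
  let opposite : FaceArc x → FaceArc x := fun α => ⟨(g α.tet α.f).1, (g α.tet α.f).2 α.f,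
    (g α.tet α.f).2 α.v, α.k, (g α.tet α.f).2.injective.ne α.ne,
    hx _ _ _ _ (hg α.tet α.f) α.v α.ne ▸ α.lt⟩
  refine two_mul_natCard_quot_of_involutive (i := opposite) ?_ ?_ ?_
  · rintro ⟨t, f, v, k, h₁, h₂⟩
    simp [opposite, hs]
  · rintro ⟨t, f, v, k, h₁, h₂⟩ h
    simp only [opposite, FaceArc.mk.injEq] at h
    exact T.glue_ne _ _ _ _ (hg t f) ⟨h.1, h.2.1⟩
  · rintro ⟨t, f, v, k, h₁, h₂⟩ ⟨t', f', v', k', h₁', h₂'⟩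
    simp only [opposite, ArcStep, FaceArc.mk.injEq]
    constructor
    · rintro ⟨σ, h, rfl, rfl, rfl⟩
      obtain rfl := congrArg Prod.snd (Option.some.inj ((hg t f).symm.trans h))
      exact ⟨(congrArg Prod.fst (Option.some.inj ((hg t f).symm.trans h))).symm, rfl, rfl, rfl⟩
    · rintro ⟨rfl, rfl, rfl, rfl⟩
      exact ⟨_, hg t f, rfl, rfl, rfl⟩

end Triangulation

theorem EdgeLabelling.two_mul_eulerChar [Fintype ι] [Fintype κ] {T : Triangulation ι}
    (E : EdgeLabelling T.glue κ) (hT : T.IsClosed) {x : ι → Disc → ℕ} (hx : T.Matching x) :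
    2 * T.eulerChar x = 2 * (∑ c, edgeWeight (x (E.rep c).1) (E.rep c).2.1 (E.rep c).2.2 : ℕ) -
      (∑ t, ((∑ v, x t (.inl v)) + 2 * ∑ q, x t (.inr q)) : ℕ) := by
  have harc := Triangulation.two_mul_natCard_arc hT hx
  have hpiece := natCard_piece x
  rw [Triangulation.eulerChar, E.natCard_point hx]
  simp only [Finset.sum_add_distrib, ← Finset.mul_sum] at harc hpiece ⊢
  omega

/-! ### Vertex normal surfaces -/

section Arcs

variable (x : ι → Disc → ℕ)

/-- The piece having the `k`-th arc, counted from `v`, around the vertex `v` of the face `f` as a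
side. The quadrilaterals are numbered from vertex `0`, hence the reversal. -/
def pieceOfArc (t : ι) (f v : Fin 4) : Fin (arcCount (x t) f v) → Piece x :=
  Fin.addCases (fun j => ⟨t, .inl v, j⟩) fun j =>
    ⟨t, .inr (quadOf v f), if v = 0 ∨ v = (quadOf v f).succ then j else j.rev⟩

theorem isSide_pieceOfArc (t : ι) {f v : Fin 4} (hv : v ≠ f) (k : Fin (arcCount (x t) f v)) :
    IsSide x (pieceOfArc x t f v k) ⟨t, f, v, k, hv, k.2⟩ := by
  induction k using Fin.addCases with
  | left j =>
    rw [pieceOfArc, Fin.addCases_left]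
    exact ⟨rfl, rfl, rfl⟩
  | right j =>
    rw [pieceOfArc, Fin.addCases_right]
    refine ⟨rfl, rfl, ?_⟩
    have := j.2
    simp only [Fin.val_natAdd]
    split_ifs
    · rfl
    · rw [Fin.val_rev]
      omega

/-- The normal coordinates of a set of pieces of a normal surface. -/
noncomputable def coordOf (K : Set (Piece x)) : ι → Disc → ℕ := fun t d =>
  ∑ j : Fin (x t d), K.indicator 1 ⟨t, d, j⟩

theorem coordOf_add_coordOf_compl (K : Set (Piece x)) : coordOf x K + coordOf x Kᶜ = x := by
  ext t d
  simp only [Pi.add_apply, coordOf, ← Finset.sum_add_distrib, Set.indicator_self_add_compl_apply]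
  simp

variable {x} in
theorem coordOf_pos {K : Set (Piece x)} {p : Piece x} (hp : p ∈ K) :
    0 < coordOf x K p.1 p.2.1 :=
  Finset.sum_pos' (fun _ _ => Nat.zero_le _) ⟨p.2.2, Finset.mem_univ _, by simp [hp]⟩

theorem arcCount_coordOf (K : Set (Piece x)) (t : ι) (f v : Fin 4) :
    arcCount (coordOf x K t) f v = ∑ k, K.indicator 1 (pieceOfArc x t f v k) := by
  have hsum := Fin.sum_univ_add (a := x t (.inl v)) (b := x t (.inr (quadOf v f)))
    fun k => K.indicator (1 : Piece x → ℕ) (pieceOfArc x t f v k)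
  refine Eq.trans ?_ hsum.symm
  simp only [pieceOfArc, Fin.addCases_left, Fin.addCases_right, arcCount, coordOf]
  congr 1
  split_ifs
  · rfl
  · exact (Equiv.sum_comp Fin.revPerm fun j => K.indicator (1 : Piece x → ℕ)
      ⟨t, .inr (quadOf v f), j⟩).symm

end Arcs

namespace Triangulation

variable {T : Triangulation ι}

theorem Matching.coordOf {x : ι → Disc → ℕ} (hx : T.Matching x) {K : Set (Piece x)}
    (hK : ∀ p q, T.PieceAdj x p q → (p ∈ K ↔ q ∈ K)) : T.Matching (coordOf x K) := by
  classical
  intro t f u σ hg v hv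
  have hv' : σ v ≠ σ f := σ.injective.ne hv
  rw [arcCount_coordOf, arcCount_coordOf]
  refine Fintype.sum_equiv (finCongr (hx t f u σ hg v hv)) _ _ fun k => ?_
  have hadj : T.PieceAdj x (pieceOfArc x t f v k)
      (pieceOfArc x u (σ f) (σ v) (finCongr (hx t f u σ hg v hv) k)) :=
    ⟨_, _, isSide_pieceOfArc x t hv k, isSide_pieceOfArc x u hv' _, σ, hg, rfl, rfl, rfl⟩
  simp only [Set.indicator_apply, hK _ _ hadj, Pi.one_apply]

theorem Matching.smul {R : Type*} [Add R] [Mul R] [LeftDistribClass R] {y : ι → Disc → R}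
    (hy : T.Matching y) (c : R) : T.Matching (c • y) := by
  intro t f u σ hg v hv
  have := hy t f u σ hg v hv
  simp only [arcCount, Pi.smul_apply, smul_eq_mul, ← mul_add] at this ⊢
  rw [this]

theorem smul_mem_solutionCone {y : ι → Disc → ℝ} (hy : y ∈ T.solutionCone) {c : ℝ} (hc : 0 ≤ c) :
    c • y ∈ T.solutionCone :=
  ⟨fun t d => mul_nonneg hc (hy.1 t d), hy.2.smul c⟩

theorem toReal_mem_solutionCone {x : ι → Disc → ℕ} (hx : T.Matching x) :
    toReal x ∈ T.solutionCone := by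
  refine ⟨fun t d => Nat.cast_nonneg _, fun t f u σ hg v hv => ?_⟩
  have := hx t f u σ hg v hv
  simp only [arcCount, toReal] at this ⊢
  exact_mod_cast this

theorem IsVertexNormal.le_of_add_eq {x y z : ι → Disc → ℕ} (hx : T.IsVertexNormal x)
    (hy : T.Matching y) (hz : T.Matching z) (hadd : y + z = x) (hy0 : y ≠ 0) : x ≤ y := by
  obtain ⟨-, -, hext, hmin⟩ := hx
  have hx : toReal x ∈ openSegment ℝ ((2 : ℝ) • toReal y) ((2 : ℝ) • toReal z) := by
    refine ⟨1 / 2, 1 / 2, by norm_num, by norm_num, by norm_num, ?_⟩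
    ext t d
    simp [toReal, ← hadd]
  obtain ⟨c, hc, hray⟩ := hext.2
    (smul_mem_solutionCone (toReal_mem_solutionCone hy) zero_le_two)
    (smul_mem_solutionCone (toReal_mem_solutionCone hz) zero_le_two)
    ⟨1, zero_le_one, (one_smul ℝ (toReal x)).symm⟩ hx
  refine hmin y hy0 ⟨c / 2, by positivity, ?_⟩
  rw [div_eq_inv_mul, mul_smul, ← hray, inv_smul_smul₀ two_ne_zero]

theorem nonempty_piece {x : ι → Disc → ℕ} (hx : x ≠ 0) : Nonempty (Piece x) := by
  obtain ⟨t, ht⟩ := Function.ne_iff.1 hx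
  obtain ⟨d, hd⟩ := Function.ne_iff.1 ht
  exact ⟨⟨t, d, ⟨0, Nat.pos_of_ne_zero hd⟩⟩⟩

theorem IsVertexNormal.isClosedConnectedSurface {x : ι → Disc → ℕ} (h : T.IsVertexNormal x)
    (hT : T.IsClosed) : T.IsClosedConnectedSurface x := by
  refine ⟨h.1, fun t f v hg _ => absurd hg (hT t f), nonempty_piece h.2.1, fun p q => ?_⟩
  let K : Set (Piece x) := {q | Relation.EqvGen (T.PieceAdj x) p q}
  have hK : ∀ q r, T.PieceAdj x q r → (q ∈ K ↔ r ∈ K) := fun q r hqr =>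
    ⟨fun h => .trans _ _ _ h (.rel _ _ hqr), fun h => .trans _ _ _ h (.symm _ _ (.rel _ _ hqr))⟩
  have hne : coordOf x K ≠ 0 := fun h0 =>
    (coordOf_pos (K := K) (Relation.EqvGen.refl p)).ne' (congrFun (congrFun h0 p.1) p.2.1)
  have hadd := coordOf_add_coordOf_compl x K
  have hle : x q.1 q.2.1 ≤ coordOf x K q.1 q.2.1 := h.le_of_add_eq (h.1.1.coordOf hK)
    (h.1.1.coordOf (K := Kᶜ) fun q r hqr => not_congr (hK q r hqr)) hadd hne q.1 q.2.1
  by_contra hq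
  have hpos : 0 < coordOf x Kᶜ q.1 q.2.1 := coordOf_pos hq
  have := congrFun (congrFun hadd q.1) q.2.1
  simp only [Pi.add_apply] at this
  omega

theorem isExtreme_ray {x : ι → Disc → ℝ} (hx : x ∈ T.solutionCone)
    (h : ∀ y ∈ T.solutionCone, (∀ t d, x t d = 0 → y t d = 0) → y ∈ ray x) :
    IsExtreme ℝ T.solutionCone (ray x) := by
  refine ⟨?_, ?_⟩
  · rintro _ ⟨c, hc, rfl⟩
    exact smul_mem_solutionCone hx hc
  · rintro y hy z hz _ ⟨c, -, rfl⟩ ⟨a, b, ha, hb, -, he⟩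
    refine h y hy fun t d h0 => ?_
    have he := congrFun (congrFun he t) d
    simp only [Pi.add_apply, Pi.smul_apply, smul_eq_mul, h0, mul_zero] at he
    exact (mul_eq_zero.1 ((add_eq_zero_iff_of_nonneg (mul_nonneg ha.le (hy.1 t d))
      (mul_nonneg hb.le (hz.1 t d))).1 he).1).resolve_left ha.ne'

theorem le_of_toReal_mem_ray {x z : ι → Disc → ℕ} {t t' : ι} {d d' : Disc}
    (hx : Nat.Coprime (x t d) (x t' d')) (hz0 : z ≠ 0) (hz : toReal z ∈ ray (toReal x)) :
    x ≤ z := by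
  obtain ⟨c, hc, hzx⟩ := hz
  have hzc : ∀ t d, (z t d : ℝ) = c * x t d := fun t d => congrFun (congrFun hzx t) d
  -- By Bézout, the factor `c` is an integer combination of the coordinates of `z`.
  have hbezout : (((x t d).gcd (x t' d') : ℤ) : ℝ) =
      x t d * (x t d).gcdA (x t' d') + x t' d' * (x t d).gcdB (x t' d') := by
    rw [Nat.gcd_eq_gcd_ab]
    push_cast
    rfl
  have hint : c = (z t d * (x t d).gcdA (x t' d') + z t' d' * (x t d).gcdB (x t' d') : ℤ) := by
    push_cast
    rw [hzc, hzc, mul_assoc, mul_assoc, ← mul_add, ← hbezout, hx]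
    simp
  have hc0 : 0 < c := by
    refine hc.lt_of_ne fun h0 => hz0 (funext₂ fun t d => ?_)
    simpa [← h0] using hzc t d
  have hc1 : 1 ≤ c := by
    rw [hint] at hc0 ⊢
    exact_mod_cast hc0
  intro t d
  exact_mod_cast (le_mul_of_one_le_left (Nat.cast_nonneg _) hc1).trans_eq (hzc t d).symm

theorem IsNormal.isVertexNormal {x : ι → Disc → ℕ} (hx : T.IsNormal x) {t t' : ι} {d d' : Disc}
    (hco : Nat.Coprime (x t d) (x t' d'))
    (hray : ∀ y ∈ T.solutionCone, (∀ t d, x t d = 0 → y t d = 0) → y ∈ ray (toReal x)) :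
    T.IsVertexNormal x := by
  refine ⟨hx, ?_, isExtreme_ray (toReal_mem_solutionCone hx.1) fun y hy h =>
    hray y hy fun t d h0 => h t d (by simp [toReal, h0]), fun z => le_of_toReal_mem_ray hco⟩
  rintro rfl
  simp at hco

/-! ### Vertex links -/

/-- The coordinates of the union of all vertex links: one triangle of each type. -/
def vertexTriangles (ι : Type*) : ι → Disc → ℕ := fun _ => Sum.elim (fun _ => 1) fun _ => 0

theorem isNormal_vertexTriangles : T.IsNormal (vertexTriangles ι) :=
  ⟨fun _ _ _ _ _ _ _ => rfl, fun _ _ _ hq => absurd rfl hq⟩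

theorem IsOneVertex.vertexLink_eq (h : T.IsOneVertex) (t : ι) (v : Fin 4) :
    T.vertexLink t v = vertexTriangles ι := by
  funext u d
  cases d <;> simp [vertexLink, vertexTriangles, h.2]

theorem VertexRel.eqvGen_pieceAdj {P Q : ι × Fin 4} (h : T.VertexRel P Q) :
    Relation.EqvGen (T.PieceAdj (vertexTriangles ι)) ⟨P.1, .inl P.2, ⟨0, Nat.zero_lt_one⟩⟩
      ⟨Q.1, .inl Q.2, ⟨0, Nat.zero_lt_one⟩⟩ := by
  refine eqvGen_map (fun P : ι × Fin 4 =>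
    (⟨P.1, .inl P.2, ⟨0, Nat.zero_lt_one⟩⟩ : Piece (vertexTriangles ι))) ?_ h
  rintro ⟨t, v⟩ ⟨u, _⟩ ⟨f, σ, hf, hg, rfl⟩
  exact .rel _ _ ⟨⟨t, f, v, 0, hf, Nat.zero_lt_one⟩,
    ⟨u, σ f, σ v, 0, σ.injective.ne hf, Nat.zero_lt_one⟩, ⟨rfl, rfl, rfl⟩, ⟨rfl, rfl, rfl⟩,
    σ, hg, rfl, rfl, rfl⟩

theorem IsOneVertex.isClosedConnectedSurface_vertexTriangles (h : T.IsOneVertex)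
    (hT : T.IsClosed) : T.IsClosedConnectedSurface (vertexTriangles ι) := by
  obtain ⟨⟨t⟩, hrel⟩ := h
  refine ⟨isNormal_vertexTriangles, fun t f v hg _ => absurd hg (hT t f),
    ⟨⟨t, .inl 0, ⟨0, Nat.zero_lt_one⟩⟩⟩, ?_⟩
  rintro ⟨t, v | q, j⟩ ⟨u, v' | q', j'⟩
  · obtain rfl : j = ⟨0, Nat.zero_lt_one⟩ := Subsingleton.elim (α := Fin 1) _ _
    obtain rfl : j' = ⟨0, Nat.zero_lt_one⟩ := Subsingleton.elim (α := Fin 1) _ _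
    exact VertexRel.eqvGen_pieceAdj (hrel (t, v) (u, v'))
  · exact absurd j'.2 (Nat.not_lt_zero _)
  · exact absurd j.2 (Nat.not_lt_zero _)
  · exact absurd j.2 (Nat.not_lt_zero _)

theorem IsOneVertex.isClosedManifold [Fintype ι] [Fintype κ] (h : T.IsOneVertex)
    (hT : T.IsClosed) (E : EdgeLabelling T.glue κ)
    (hκ : Fintype.card κ = Fintype.card ι + 1) : T.IsClosedManifold := by
  refine ⟨hT, fun t v => ?_⟩
  rw [h.vertexLink_eq]
  refine ⟨h.isClosedConnectedSurface_vertexTriangles hT, ?_⟩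
  have hχ := E.two_mul_eulerChar hT isNormal_vertexTriangles.1
  simp [edgeWeight, vertexTriangles, hκ] at hχ
  omega

end Triangulation

/-! ### Gluing two triangulations along their boundaries -/

/-- A pairing of the boundary faces of `T₁` with those of `T₂`: if `toRight t f = (u, σ)` for a
boundary face `f` of `t`, then this face is matched with face `σ f` of `u` by `σ`. The values on
glued faces are irrelevant. -/
structure BoundaryPairing (T₁ : Triangulation ι) (T₂ : Triangulation κ) where
  toRight : ι → Fin 4 → κ × Equiv.Perm (Fin 4)
  toLeft : κ → Fin 4 → ι × Equiv.Perm (Fin 4)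
  toRight_spec : ∀ t f, T₁.glue t f = none →
    T₂.glue (toRight t f).1 ((toRight t f).2 f) = none ∧
      toLeft (toRight t f).1 ((toRight t f).2 f) = (t, (toRight t f).2.symm)
  toLeft_spec : ∀ u f, T₂.glue u f = none →
    T₁.glue (toLeft u f).1 ((toLeft u f).2 f) = none ∧
      toRight (toLeft u f).1 ((toLeft u f).2 f) = (u, (toLeft u f).2.symm)

namespace BoundaryPairing

variable {T₁ : Triangulation ι} {T₂ : Triangulation κ} (B : BoundaryPairing T₁ T₂)

/-- The face gluings of the union of `T₁` and `T₂` along a boundary pairing: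
`B.Glued t f u σ` says that face `f` of `t` is glued to face `σ f` of `u` by `σ`. -/
inductive Glued : ι ⊕ κ → Fin 4 → ι ⊕ κ → Equiv.Perm (Fin 4) → Prop
  | left {t f u σ} : T₁.glue t f = some (u, σ) → Glued (.inl t) f (.inl u) σ
  | right {t f u σ} : T₂.glue t f = some (u, σ) → Glued (.inr t) f (.inr u) σ
  | toRight {t f} : T₁.glue t f = none →
      Glued (.inl t) f (.inr (B.toRight t f).1) (B.toRight t f).2
  | toLeft {t f} : T₂.glue t f = none →
      Glued (.inr t) f (.inl (B.toLeft t f).1) (B.toLeft t f).2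

theorem Glued.symm {t u : ι ⊕ κ} {f : Fin 4} {σ : Equiv.Perm (Fin 4)} (h : B.Glued t f u σ) :
    B.Glued u (σ f) t σ.symm := by
  cases h with
  | left h => exact .left (T₁.glue_symm _ _ _ _ h)
  | right h => exact .right (T₂.glue_symm _ _ _ _ h)
  | toRight h =>
    obtain ⟨hnone, heq⟩ := B.toRight_spec _ _ h
    have := Glued.toLeft (B := B) hnone
    rwa [heq] at this
  | toLeft h =>
    obtain ⟨hnone, heq⟩ := B.toLeft_spec _ _ h
    have := Glued.toRight (B := B) hnone
    rwa [heq] at this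

theorem Glued.ne {t u : ι ⊕ κ} {f : Fin 4} {σ : Equiv.Perm (Fin 4)} (h : B.Glued t f u σ) :
    ¬(u = t ∧ σ f = f) := by
  cases h with
  | left h => exact fun h' => T₁.glue_ne _ _ _ _ h ⟨Sum.inl_injective h'.1, h'.2⟩
  | right h => exact fun h' => T₂.glue_ne _ _ _ _ h ⟨Sum.inr_injective h'.1, h'.2⟩
  | toRight h => exact fun h' => Sum.inr_ne_inl h'.1
  | toLeft h => exact fun h' => Sum.inl_ne_inr h'.1

/-- The image of each face under the gluings of the union. -/
def glueSum : ι ⊕ κ → Fin 4 → (ι ⊕ κ) × Equiv.Perm (Fin 4)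
  | .inl t, f => (T₁.glue t f).elim (.inr (B.toRight t f).1, (B.toRight t f).2)
      fun p => (.inl p.1, p.2)
  | .inr t, f => (T₂.glue t f).elim (.inl (B.toLeft t f).1, (B.toLeft t f).2)
      fun p => (.inr p.1, p.2)

theorem glueSum_eq_iff {t u : ι ⊕ κ} {f : Fin 4} {σ : Equiv.Perm (Fin 4)} :
    B.glueSum t f = (u, σ) ↔ B.Glued t f u σ := by
  constructor
  · intro h
    cases t with
    | inl t =>
      cases hg : T₁.glue t f with
      | none =>
        simp only [glueSum, hg, Option.elim_none, Prod.mk.injEq] at h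
        obtain ⟨rfl, rfl⟩ := h
        exact .toRight hg
      | some p =>
        simp only [glueSum, hg, Option.elim_some, Prod.mk.injEq] at h
        obtain ⟨rfl, rfl⟩ := h
        exact .left hg
    | inr t =>
      cases hg : T₂.glue t f with
      | none =>
        simp only [glueSum, hg, Option.elim_none, Prod.mk.injEq] at h
        obtain ⟨rfl, rfl⟩ := h
        exact .toLeft hg
      | some p =>
        simp only [glueSum, hg, Option.elim_some, Prod.mk.injEq] at h
        obtain ⟨rfl, rfl⟩ := h
        exact .right hg
  · rintro (h | h | h | h) <;> simp [glueSum, h]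

/-- The gluings of the union, with tetrahedra relabelled by `e`. -/
def glue (e : ι ⊕ κ ≃ lam) : Gluing lam := fun t f =>
  some (e (B.glueSum (e.symm t) f).1, (B.glueSum (e.symm t) f).2)

theorem glue_eq_some_iff {e : ι ⊕ κ ≃ lam} {t u : ι ⊕ κ} {f : Fin 4} {σ : Equiv.Perm (Fin 4)} :
    B.glue e (e t) f = some (e u, σ) ↔ B.Glued t f u σ := by
  rw [← glueSum_eq_iff, glue, e.symm_apply_apply, Option.some_inj, Prod.mk.injEq, e.apply_eq_iff_eq,
    Prod.ext_iff]

/-- The labels of `E₁` and `E₂` agree on paired boundary faces. -/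
def Compatible (E₁ : EdgeLabelling T₁.glue κ₁) (E₂ : EdgeLabelling T₂.glue κ₂) : Prop :=
  ∀ t f, T₁.glue t f = none → ∀ a b, a ≠ b → a ≠ f → b ≠ f →
    E₂.label (B.toRight t f).1 ((B.toRight t f).2 a) ((B.toRight t f).2 b) = E₁.label t a b

variable {B} {E₁ : EdgeLabelling T₁.glue κ₁} {E₂ : EdgeLabelling T₂.glue κ₂}

theorem Compatible.label_eq (h : B.Compatible E₁ E₂) {t u : ι ⊕ κ} {f : Fin 4}
    {σ : Equiv.Perm (Fin 4)} (hg : B.Glued t f u σ) {a b : Fin 4} (hab : a ≠ b) (ha : a ≠ f)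
    (hb : b ≠ f) :
    Sum.elim E₁.label E₂.label u (σ a) (σ b) = Sum.elim E₁.label E₂.label t a b := by
  cases hg with
  | left hg => exact E₁.step _ _ _ _ hg a b hab ha hb
  | right hg => exact E₂.step _ _ _ _ hg a b hab ha hb
  | toRight hg => exact h _ _ hg a b hab ha hb
  | @toLeft t f hg =>
    obtain ⟨hnone, heq⟩ := B.toLeft_spec _ _ hg
    have := h _ _ hnone ((B.toLeft t f).2 a) ((B.toLeft t f).2 b) (by simpa) (by simpa) (by simpa)
    simpa [heq] using this.symm

/-- The union of two triangulations along a boundary pairing, with tetrahedra relabelled by `e`.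
Compatible labels exclude reversed edges. -/
def union (e : ι ⊕ κ ≃ lam) (h : B.Compatible E₁ E₂) : Triangulation lam where
  glue := B.glue e
  glue_symm := by
    intro t f u σ hg
    obtain ⟨t, rfl⟩ := e.surjective t
    obtain ⟨u, rfl⟩ := e.surjective u
    rw [glue_eq_some_iff] at hg ⊢
    exact hg.symm
  glue_ne := by
    intro t f u σ hg
    obtain ⟨t, rfl⟩ := e.surjective t
    obtain ⟨u, rfl⟩ := e.surjective u
    rw [glue_eq_some_iff] at hg
    rw [e.apply_eq_iff_eq]
    exact hg.ne
  no_reverse := by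
    refine no_reverse_of_label _ (fun t => Sum.elim E₁.label E₂.label (e.symm t)) ?_ ?_
    · intro t a b hab
      cases e.symm t with
      | inl t => exact ⟨E₁.ne_zero t a b hab, E₁.swap t a b hab⟩
      | inr t => exact ⟨E₂.ne_zero t a b hab, E₂.swap t a b hab⟩
    · intro t f u σ hg a b hab ha hb
      obtain ⟨t, rfl⟩ := e.surjective t
      obtain ⟨u, rfl⟩ := e.surjective u
      simpa using h.label_eq ((B.glue_eq_some_iff).1 hg) hab ha hb

variable (e : ι ⊕ κ ≃ lam) (h : B.Compatible E₁ E₂)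

theorem union_glue_of_glued {t u : ι ⊕ κ} {f : Fin 4} {σ : Equiv.Perm (Fin 4)}
    (hg : B.Glued t f u σ) : (union e h).glue (e t) f = some (e u, σ) :=
  B.glue_eq_some_iff.2 hg

theorem isBoundaryUnion_union : T₁.IsBoundaryUnion T₂ (union e h) := by
  have hcap : ∀ {t f u σ}, T₁.glue t f = none →
      (union e h).glue (e (.inl t)) f = some (e (.inr u), σ) → ∀ {a b}, a ≠ b → a ≠ f → b ≠ f →
      E₂.label u (σ a) (σ b) = E₁.label t a b := fun _ hglue _ _ hab ha hb =>
    h.label_eq (B.glue_eq_some_iff.1 hglue) hab ha hb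
  refine ⟨e, fun _ _ _ _ hg => union_glue_of_glued e h (.left hg),
    fun _ _ _ _ hg => union_glue_of_glued e h (.right hg),
    fun t f hg => ⟨_, _, (B.toRight_spec t f hg).1, union_glue_of_glued e h (.toRight hg)⟩,
    fun t f hg => ⟨_, _, (B.toLeft_spec t f hg).1, union_glue_of_glued e h (.toLeft hg)⟩, ?_⟩
  intro t f u σ t' f' u' σ' hnone hnone' hg hg' a b a' b' hab ha hb hab' ha' hb'
  rw [E₁.edgeRel_iff hab hab', E₂.edgeRel_iff (by simpa) (by simpa), hcap hnone hg hab ha hb,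
    hcap hnone' hg' hab' ha' hb']

theorem matching_union_iff {R : Type*} [Add R] {y : lam → Disc → R} :
    (union e h).Matching y ↔
      T₁.Matching (fun t => y (e (.inl t))) ∧ T₂.Matching (fun t => y (e (.inr t))) ∧
      ∀ t f, T₁.glue t f = none → ∀ v, v ≠ f → arcCount (y (e (.inl t))) f v =
        arcCount (y (e (.inr (B.toRight t f).1))) ((B.toRight t f).2 f) ((B.toRight t f).2 v) := by
  constructor
  · exact fun hy => ⟨fun _ _ _ _ hg => hy _ _ _ _ (union_glue_of_glued e h (.left hg)),
      fun _ _ _ _ hg => hy _ _ _ _ (union_glue_of_glued e h (.right hg)),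
      fun _ _ hg => hy _ _ _ _ (union_glue_of_glued e h (.toRight hg))⟩
  · rintro ⟨h₁, h₂, hcap⟩ t f u σ hg v hv
    obtain ⟨t, rfl⟩ := e.surjective t
    obtain ⟨u, rfl⟩ := e.surjective u
    cases B.glue_eq_some_iff.1 hg with
    | left hleft => exact h₁ _ _ _ _ hleft v hv
    | right hright => exact h₂ _ _ _ _ hright v hv
    | toRight hnone => exact hcap _ _ hnone v hv
    | @toLeft t f hnone =>
      obtain ⟨hnone', heq⟩ := B.toLeft_spec _ _ hnone
      have := hcap _ _ hnone' ((B.toLeft t f).2 v) (by simpa)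
      simpa [heq] using this.symm

theorem edgeRel_union_inl {p q : ι × Fin 4 × Fin 4} (hpq : EdgeRel T₁.glue p q) :
    EdgeRel (union e h).glue (e (.inl p.1), p.2) (e (.inl q.1), q.2) :=
  hpq.map (fun p => (e (.inl p.1), p.2)) fun _ _ _ _ hg _ _ hab ha hb =>
    EdgeRel.of_glue (union_glue_of_glued e h (.left hg)) hab ha hb

theorem edgeRel_union_inr {p q : κ × Fin 4 × Fin 4} (hpq : EdgeRel T₂.glue p q) :
    EdgeRel (union e h).glue (e (.inr p.1), p.2) (e (.inr q.1), q.2) :=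
  hpq.map (fun p => (e (.inr p.1), p.2)) fun _ _ _ _ hg _ _ hab ha hb =>
    EdgeRel.of_glue (union_glue_of_glued e h (.right hg)) hab ha hb

variable {e} in
theorem exists_rep_union_inl (t : ι) {a b : Fin 4} (hab : a ≠ b) : ∃ c,
    EdgeRel (union e h).glue (e (.inl t), a, b) (e (.inl (E₁.rep c).1), (E₁.rep c).2) ∨
      EdgeRel (union e h).glue (e (.inl t), b, a) (e (.inl (E₁.rep c).1), (E₁.rep c).2) :=
  (E₁.exists_rep t a b hab).imp fun _ hc =>
    hc.imp (edgeRel_union_inl e h) (edgeRel_union_inl e h)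

/-- The edges `inner c` of `T₂` include all its edges that do not lie in the boundary. -/
def CoversInterior (E₂ : EdgeLabelling T₂.glue κ₂) (inner : κ' ↪ κ₂) : Prop :=
  ∀ c, c ∉ Set.range inner → ∃ t f, T₂.glue t f = none ∧ ∃ a b, a ≠ b ∧ a ≠ f ∧ b ≠ f ∧
    EdgeRel T₂.glue (E₂.rep c) (t, a, b)

/-- The representative edges of `T₁` and of the edges `inner c` of `T₂`. -/
def unionRep (E₁ : EdgeLabelling T₁.glue κ₁) (E₂ : EdgeLabelling T₂.glue κ₂) (inner : κ' ↪ κ₂) :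
    κ₁ ⊕ κ' → lam × Fin 4 × Fin 4 :=
  Sum.elim (fun c => (e (.inl (E₁.rep c).1), (E₁.rep c).2))
    fun c => (e (.inr (E₂.rep (inner c)).1), (E₂.rep (inner c)).2)

variable {e} in
theorem exists_rep_union {inner : κ' ↪ κ₂} (hinner : CoversInterior E₂ inner) (t : lam)
    {a b : Fin 4} (hab : a ≠ b) : ∃ c,
    EdgeRel (union e h).glue (t, a, b) (unionRep e E₁ E₂ inner c) ∨
      EdgeRel (union e h).glue (t, b, a) (unionRep e E₁ E₂ inner c) := by
  obtain ⟨t | t, rfl⟩ := e.surjective t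
  · obtain ⟨c, hc⟩ := exists_rep_union_inl (e := e) h t hab
    exact ⟨.inl c, hc⟩
  obtain ⟨c, hc⟩ := E₂.exists_rep t a b hab
  replace hc := hc.imp (edgeRel_union_inr e h) (edgeRel_union_inr e h)
  by_cases hmem : c ∈ Set.range inner
  · obtain ⟨c, rfl⟩ := hmem
    exact ⟨.inr c, hc⟩
  obtain ⟨u, f, hg, a', b', hab', ha, hb, hrel⟩ := hinner c hmem
  have hcross := (edgeRel_union_inr e h hrel).trans
    (EdgeRel.of_glue (union_glue_of_glued e h (.toLeft hg)) hab' ha hb)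
  obtain ⟨c', hc'⟩ := exists_rep_union_inl (e := e) h (B.toLeft u f).1
    ((B.toLeft u f).2.injective.ne hab')
  refine ⟨.inl c', ?_⟩
  rcases hc with hc | hc <;> rcases hc' with hc' | hc'
  · exact .inl ((hc.trans hcross).trans hc')
  · exact .inr ((hc.trans hcross).swap.trans hc')
  · exact .inr ((hc.trans hcross).trans hc')
  · exact .inl ((hc.trans hcross).swap.trans hc')

/-- The edges of the union: those of `T₁`, and the edges `inner c` of `T₂`. -/
def unionLabelling {inner : κ' ↪ κ₂} (hinner : CoversInterior E₂ inner)
    (hdisj : ∀ c c', (E₁.label (E₁.rep c).1 (E₁.rep c).2.1 (E₁.rep c).2.2).natAbs ≠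
      (E₂.label (E₂.rep (inner c')).1 (E₂.rep (inner c')).2.1 (E₂.rep (inner c')).2.2).natAbs) :
    EdgeLabelling (union e h).glue (κ₁ ⊕ κ') where
  label t := Sum.elim E₁.label E₂.label (e.symm t)
  ne_zero t a b hab := by
    cases e.symm t with
    | inl t => exact E₁.ne_zero t a b hab
    | inr t => exact E₂.ne_zero t a b hab
  swap t a b hab := by
    cases e.symm t with
    | inl t => exact E₁.swap t a b hab
    | inr t => exact E₂.swap t a b hab
  step t f u σ hg a b hab ha hb := by
    obtain ⟨t, rfl⟩ := e.surjective t
    obtain ⟨u, rfl⟩ := e.surjective u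
    simpa using h.label_eq (B.glue_eq_some_iff.1 hg) hab ha hb
  rep := unionRep e E₁ E₂ inner
  rep_ne := by
    rintro (c | c)
    · exact E₁.rep_ne c
    · exact E₂.rep_ne (inner c)
  rep_injective := by
    rintro (c | c) (c' | c') hc <;>
      simp only [unionRep, Sum.elim_inl, Sum.elim_inr, Equiv.symm_apply_apply] at hc
    · rw [E₁.rep_injective hc]
    · exact absurd hc (hdisj c c')
    · exact absurd hc.symm (hdisj c' c)
    · rw [inner.injective (E₂.rep_injective hc)]
  exists_rep t _ _ hab := exists_rep_union h hinner t hab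

end BoundaryPairing

namespace Triangulation

variable {T₁ : Triangulation ι} {T₂ : Triangulation κ} {T : Triangulation lam}

theorem IsBoundaryUnion.isClosed (h : T₁.IsBoundaryUnion T₂ T) : T.IsClosed := by
  obtain ⟨e, h₁, h₂, hcap₁, hcap₂, -⟩ := h
  intro t f
  obtain ⟨t | t, rfl⟩ := e.surjective t
  · cases hg : T₁.glue t f with
    | none =>
      obtain ⟨u, σ, -, hcap⟩ := hcap₁ t f hg
      simp [hcap]
    | some p => simp [h₁ t f p.1 p.2 hg]
  · cases hg : T₂.glue t f with
    | none =>
      obtain ⟨u, σ, -, hcap⟩ := hcap₂ t f hg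
      simp [hcap]
    | some p => simp [h₂ t f p.1 p.2 hg]

theorem VertexRel.map {T' : Triangulation κ} {φ : ι → κ}
    (hφ : ∀ t f u σ, T₁.glue t f = some (u, σ) → T'.glue (φ t) f = some (φ u, σ))
    {p q : ι × Fin 4} (h : T₁.VertexRel p q) : T'.VertexRel (φ p.1, p.2) (φ q.1, q.2) :=
  eqvGen_map (fun p : ι × Fin 4 => (φ p.1, p.2))
    (fun _ _ ⟨f, σ, hf, hg, hσ⟩ => .rel _ _ ⟨f, σ, hf, hφ _ _ _ _ hg, hσ⟩) h

theorem IsBoundaryUnion.isOneVertex (h : T₁.IsBoundaryUnion T₂ T) (h₁ : T₁.IsOneVertex)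
    (h₂ : T₂.IsOneVertex) (hT₁ : ¬T₁.IsClosed) : T.IsOneVertex := by
  obtain ⟨e, hg₁, hg₂, hcap, -, -⟩ := h
  simp only [IsClosed, not_forall, not_not] at hT₁
  obtain ⟨t₀, f₀, hnone⟩ := hT₁
  obtain ⟨u₀, σ, -, hglue⟩ := hcap t₀ f₀ hnone
  obtain ⟨v₀, hv₀⟩ := exists_ne f₀
  have hcross : T.VertexRel (e (.inl t₀), v₀) (e (.inr u₀), σ v₀) :=
    .rel _ _ ⟨f₀, σ, hv₀, hglue, rfl⟩
  have hall : ∀ p, T.VertexRel p (e (.inl t₀), v₀) := by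
    rintro ⟨t, v⟩
    obtain ⟨t | t, rfl⟩ := e.surjective t
    · exact (h₁.2 (t, v) (t₀, v₀)).map (φ := fun t => e (.inl t)) hg₁
    · exact ((h₂.2 (t, v) (u₀, σ v₀)).map (φ := fun t => e (.inr t)) hg₂).trans _ _ _
        (.symm _ _ hcross)
  exact ⟨⟨e (.inl t₀)⟩, fun p q => .trans _ _ _ (hall p) (.symm _ _ (hall q))⟩

end Triangulation

namespace Triangulation

variable {T : Triangulation ι}

theorem VertexRel.of_glue {t u : ι} {f v : Fin 4} {σ : Equiv.Perm (Fin 4)}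
    (h : T.glue t f = some (u, σ)) (hv : v ≠ f) : T.VertexRel (t, v) (u, σ v) :=
  .rel _ _ ⟨f, σ, hv, h, rfl⟩

theorem VertexRel.symm {p q : ι × Fin 4} (h : T.VertexRel p q) : T.VertexRel q p :=
  Relation.EqvGen.symm _ _ h

theorem VertexRel.trans {p q r : ι × Fin 4} (h : T.VertexRel p q) (h' : T.VertexRel q r) :
    T.VertexRel p r :=
  Relation.EqvGen.trans _ _ _ h h'

theorem isOneVertex_of_vertexRel (r : ι × Fin 4) (h : ∀ p, T.VertexRel p r) : T.IsOneVertex :=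
  ⟨⟨r.1⟩, fun p q => (h p).trans (h q).symm⟩

end Triangulation

theorem EdgeRel.vertexRel {T : Triangulation ι} {p q : ι × Fin 4 × Fin 4}
    (h : EdgeRel T.glue p q) : T.VertexRel (p.1, p.2.1) (q.1, q.2.1) := by
  refine eqvGen_map (fun p : ι × Fin 4 × Fin 4 => (p.1, p.2.1)) ?_ h
  rintro ⟨t, a, b⟩ ⟨u, _, _⟩ ⟨-, f, σ, ha, -, hg, rfl, rfl⟩
  exact Triangulation.VertexRel.of_glue hg ha

theorem EdgeLabelling.vertexRel {T : Triangulation ι} (E : EdgeLabelling T.glue κ) {t t' : ι}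
    {a b a' b' : Fin 4} (hab : a ≠ b) (hab' : a' ≠ b')
    (h : E.label t a b = E.label t' a' b') : T.VertexRel (t, a) (t', a') :=
  ((E.edgeRel_iff hab hab').2 h).vertexRel

/-! ### The layered solid tori -/

theorem layeredGlue_eq_none {m : ℕ} {i : Fin (m + 1)} {f : Fin 4} :
    layeredGlue (m + 1) i f = none ↔ i = Fin.last m ∧ (f = 2 ∨ f = 3) := by
  obtain ⟨i, hi⟩ := i
  fin_cases f <;> simp [layeredGlue, Fin.ext_iff] <;> grind

theorem layeredGlue_zero (m : ℕ) : layeredGlue (m + 1) 0 1 = some (0, foldPerm) := by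
  simp [layeredGlue_eq_some]

theorem layeredGlue_succ_zero {m : ℕ} (k : Fin m) :
    layeredGlue (m + 1) k.succ 0 = some (k.castSucc, layerPerm₀) := by
  simp [layeredGlue_eq_some]

theorem layeredGlue_succ_one {m : ℕ} (k : Fin m) :
    layeredGlue (m + 1) k.succ 1 = some (k.castSucc, layerPerm₁) := by
  simp [layeredGlue_eq_some]

/-- Representatives of the edges of the layered solid torus: the edges `02` and `03` of the first
tetrahedron and the edge `01` of every tetrahedron. -/
def layeredRep (m : ℕ) : Fin 2 ⊕ Fin (m + 1) → Fin (m + 1) × Fin 4 × Fin 4 :=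
  Sum.elim ![(0, 0, 2), (0, 0, 3)] fun k => (k, 0, 1)

theorem exists_layeredRep_zero (m : ℕ) {a b : Fin 4} (hab : a ≠ b) : ∃ c,
    EdgeRel (layeredGlue (m + 1)) (0, a, b) (layeredRep m c) ∨
      EdgeRel (layeredGlue (m + 1)) (0, b, a) (layeredRep m c) := by
  have h23 : EdgeRel (layeredGlue (m + 1)) (0, 0, 2) (0, 2, 3) :=
    .of_glue (layeredGlue_zero m) (by decide) (by decide) (by decide)
  have h31 : EdgeRel (layeredGlue (m + 1)) (0, 0, 2) (0, 3, 1) :=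
    h23.trans (.of_glue (layeredGlue_zero m) (by decide) (by decide) (by decide))
  have h21 : EdgeRel (layeredGlue (m + 1)) (0, 0, 3) (0, 2, 1) :=
    .of_glue (layeredGlue_zero m) (by decide) (by decide) (by decide)
  have hcover : ∀ e ∈ [((0 : Fin 4), (1 : Fin 4)), (0, 2), (0, 3), (2, 3), (3, 1), (2, 1)],
      ∃ c, EdgeRel (layeredGlue (m + 1)) (0, e) (layeredRep m c) := by
    simp only [List.forall_mem_cons, List.not_mem_nil, false_imp_iff, implies_true, and_true]
    exact ⟨⟨.inr 0, .refl _⟩, ⟨.inl 0, .refl _⟩, ⟨.inl 1, .refl _⟩, ⟨.inl 0, h23.symm⟩,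
      ⟨.inl 0, h31.symm⟩, ⟨.inl 1, h21.symm⟩⟩
  have hmem : (a, b) ∈ [((0 : Fin 4), (1 : Fin 4)), (0, 2), (0, 3), (2, 3), (3, 1), (2, 1)] ∨
      (b, a) ∈ [((0 : Fin 4), (1 : Fin 4)), (0, 2), (0, 3), (2, 3), (3, 1), (2, 1)] := by
    revert a b; decide
  rcases hmem with hmem | hmem
  · exact (hcover _ hmem).imp fun _ => .inl
  · exact (hcover _ hmem).imp fun _ => .inr

theorem exists_edgeRel_castSucc {m : ℕ} (k : Fin m) {a b : Fin 4} (hab : a ≠ b)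
    (h01 : ¬(a = 0 ∧ b = 1)) (h10 : ¬(a = 1 ∧ b = 0)) :
    ∃ a' b', a' ≠ b' ∧ EdgeRel (layeredGlue (m + 1)) (k.succ, a, b) (k.castSucc, a', b') := by
  have hface : (a ≠ 0 ∧ b ≠ 0) ∨ (a ≠ 1 ∧ b ≠ 1) := by omega
  rcases hface with h | h
  · exact ⟨_, _, layerPerm₀.injective.ne hab, .of_glue (layeredGlue_succ_zero k) hab h.1 h.2⟩
  · exact ⟨_, _, layerPerm₁.injective.ne hab, .of_glue (layeredGlue_succ_one k) hab h.1 h.2⟩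

theorem exists_layeredRep (m : ℕ) (k : Fin (m + 1)) : ∀ a b : Fin 4, a ≠ b → ∃ c,
    EdgeRel (layeredGlue (m + 1)) (k, a, b) (layeredRep m c) ∨
      EdgeRel (layeredGlue (m + 1)) (k, b, a) (layeredRep m c) := by
  induction k using Fin.induction with
  | zero => exact fun a b hab => exists_layeredRep_zero m hab
  | succ k ih =>
    intro a b hab
    by_cases h01 : a = 0 ∧ b = 1
    · exact ⟨.inr k.succ, .inl (h01.1 ▸ h01.2 ▸ .refl _)⟩
    by_cases h10 : a = 1 ∧ b = 0
    · exact ⟨.inr k.succ, .inr (h10.1 ▸ h10.2 ▸ .refl _)⟩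
    obtain ⟨a', b', hab', hr⟩ := exists_edgeRel_castSucc k hab h01 h10
    exact (ih a' b' hab').imp fun _ hc => hc.imp hr.trans hr.swap.trans

/-- Renumbering of the edge classes of the layered solid torus with `m + 1` tetrahedra by
`z ↦ m + 8 - z`, with a sign: the boundary edges get the labels `4`, `5`, `6` that they have in the
plug, and all other labels are larger. -/
def renumber (m : ℕ) (z : ℤ) : ℤ := (-1) ^ m * (z - (m + 8) * z.sign)

theorem renumber_neg (m : ℕ) (z : ℤ) : renumber m (-z) = -renumber m z := by
  simp only [renumber, Int.sign_neg]
  ring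

theorem natAbs_renumber {m : ℕ} {z : ℤ} (h₀ : z ≠ 0) (h : z.natAbs ≤ m + 8) :
    (renumber m z).natAbs = m + 8 - z.natAbs := by
  rw [renumber, Int.natAbs_mul, Int.natAbs_pow, Int.natAbs_neg, Int.natAbs_one, one_pow, one_mul]
  rcases lt_or_gt_of_ne h₀ with h₀ | h₀
  · rw [Int.sign_eq_neg_one_of_neg h₀]
    omega
  · rw [Int.sign_eq_one_of_pos h₀]
    omega

theorem layeredLabel_swap (k : ℕ) (a b : Fin 4) :
    layeredLabel k b a = -layeredLabel k a b := by
  fin_cases a <;> fin_cases b <;> simp [layeredLabel]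

theorem natAbs_layeredLabel (k : ℕ) {a b : Fin 4} (hab : a ≠ b) :
    2 ≤ (layeredLabel k a b).natAbs ∧ (layeredLabel k a b).natAbs ≤ k + 4 := by
  fin_cases a <;> fin_cases b <;> simp [layeredLabel] at hab ⊢ <;> grind

theorem natAbs_renumber_layeredLabel {m k : ℕ} (hk : k ≤ m) {a b : Fin 4} (hab : a ≠ b) :
    (renumber m ((-1) ^ k * layeredLabel k a b)).natAbs =
      m + 8 - (layeredLabel k a b).natAbs := by
  have hbound := natAbs_layeredLabel k hab
  have habs : ((-1) ^ k * layeredLabel k a b).natAbs = (layeredLabel k a b).natAbs := by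
    simp [Int.natAbs_mul, Int.natAbs_pow]
  rw [natAbs_renumber (by omega) (by omega), habs]

theorem layeredRep_ne (m : ℕ) (c : Fin 2 ⊕ Fin (m + 1)) :
    (layeredRep m c).2.1 ≠ (layeredRep m c).2.2 := by
  rcases c with c | _
  · fin_cases c <;> simp [layeredRep]
  · exact zero_ne_one

theorem natAbs_layeredLabel_layeredRep (m : ℕ) (c : Fin 2 ⊕ Fin (m + 1)) :
    (layeredLabel (layeredRep m c).1 (layeredRep m c).2.1 (layeredRep m c).2.2).natAbs =
      Sum.elim (fun i : Fin 2 => (i : ℕ) + 2) (fun k : Fin (m + 1) => (k : ℕ) + 4) c := by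
  rcases c with c | c
  · fin_cases c <;> simp [layeredRep, layeredLabel]
  · simp [layeredRep, layeredLabel]
    omega

/-- The edges of the layered solid torus, distinguished by their renumbered classes. -/
def layeredLabelling (m : ℕ) :
    EdgeLabelling (layeredSolidTorus (m + 1)).glue (Fin 2 ⊕ Fin (m + 1)) where
  label t a b := renumber m ((-1) ^ (t : ℕ) * layeredLabel t a b)
  ne_zero t a b hab := by
    have := natAbs_renumber_layeredLabel (Nat.le_of_lt_succ t.2) hab
    have := natAbs_layeredLabel t hab
    omega
  swap t a b _ := by rw [layeredLabel_swap, mul_neg, renumber_neg]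
  step t f u σ h a b hab ha hb := congrArg _ (layeredGlue_label (m + 1) t f u σ h a b hab ha hb)
  rep := layeredRep m
  rep_ne := layeredRep_ne m
  rep_injective := by
    intro c c' h
    simp only [natAbs_renumber_layeredLabel (Nat.le_of_lt_succ (layeredRep m _).1.2)
      (layeredRep_ne m _), natAbs_layeredLabel_layeredRep] at h
    rcases c with c | c <;> rcases c' with c' | c' <;> simp only [Sum.elim_inl, Sum.elim_inr] at h
    · exact congrArg _ (Fin.ext (by omega))
    · omega
    · omega
    · exact congrArg _ (Fin.ext (by omega))
  exists_rep := exists_layeredRep m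

theorem layeredSolidTorus_isOneVertex (m : ℕ) : (layeredSolidTorus (m + 1)).IsOneVertex := by
  refine Triangulation.isOneVertex_of_vertexRel (0, 0) ?_
  rintro ⟨k, v⟩
  induction k using Fin.induction generalizing v with
  | zero =>
    have hfold : ∀ v, v ≠ 1 → (layeredSolidTorus (m + 1)).VertexRel (0, v) (0, foldPerm v) :=
      fun v hv => .of_glue (f := 1) (layeredGlue_zero m) hv
    have h2 : (layeredSolidTorus (m + 1)).VertexRel (0, 2) (0, 0) := (hfold 0 (by decide)).symm
    have h3 : (layeredSolidTorus (m + 1)).VertexRel (0, 3) (0, 0) :=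
      (hfold 2 (by decide)).symm.trans h2
    have h1 : (layeredSolidTorus (m + 1)).VertexRel (0, 1) (0, 0) :=
      (hfold 3 (by decide)).symm.trans h3
    fin_cases v
    exacts [.refl _, h1, h2, h3]
  | succ k ih =>
    by_cases hv : v = 0
    · exact (Triangulation.VertexRel.of_glue (layeredGlue_succ_one k)
        (hv ▸ zero_ne_one)).trans (ih _)
    · exact (Triangulation.VertexRel.of_glue (layeredGlue_succ_zero k) hv).trans (ih _)

/-! ### The plug -/

theorem plugGlue_eq_none : ∀ {j f : Fin 4}, plugGlue j f = none ↔ j = 3 ∧ (f = 0 ∨ f = 2) := by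
  decide

/-- The oriented edge reached from `e` by crossing the faces in the list `l`, one after the other;
faces that do not contain the current edge and boundary faces are not crossed. -/
def edgeWalk (g : Gluing ι) : ι × Fin 4 × Fin 4 → List (Fin 4) → ι × Fin 4 × Fin 4
  | e, [] => e
  | e, f :: l =>
    if e.2.1 ≠ f ∧ e.2.2 ≠ f then
      match g e.1 f with
      | some (u, σ) => edgeWalk g (u, σ e.2.1, σ e.2.2) l
      | none => edgeWalk g e l
    else edgeWalk g e l

theorem edgeRel_edgeWalk (g : Gluing ι) (l : List (Fin 4)) {e : ι × Fin 4 × Fin 4}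
    (he : e.2.1 ≠ e.2.2) : EdgeRel g e (edgeWalk g e l) := by
  induction l generalizing e with
  | nil => exact .refl _
  | cons f l ih =>
    rw [edgeWalk]
    split_ifs with h
    · split
      · next u σ hg => exact (EdgeRel.of_glue hg he h.1 h.2).trans (ih (σ.injective.ne he))
      · exact ih he
    · exact ih he

/-- Representatives of the edges of the plug. -/
def plugRep : Fin 6 → Fin 4 × Fin 4 × Fin 4 :=
  ![(0, 0, 1), (0, 0, 2), (3, 2, 0), (3, 1, 2), (3, 3, 2), (3, 1, 3)]

/-- The faces that are crossed when going once around an edge of the plug, starting from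
`plugRep`. -/
def plugWalk : Fin 6 → List (Fin 4) :=
  ![[2, 0, 1], [1, 3, 0, 2, 2], [1, 1, 2], [3, 0, 3, 2], [1, 3, 3], []]

theorem exists_edgeWalk_plugRep : ∀ t a b : Fin 4, 0 < plugLabel t a b →
    ∃ (c : Fin 6) (k : Fin 6), edgeWalk plugGlue (plugRep c) ((plugWalk c).take k) = (t, a, b) := by
  decide

theorem plugLabel_plugRep : ∀ c : Fin 6,
    plugLabel (plugRep c).1 (plugRep c).2.1 (plugRep c).2.2 = (c : ℕ) + 1 := by
  decide

theorem plugRep_ne : ∀ c, (plugRep c).2.1 ≠ (plugRep c).2.2 := by decide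

theorem exists_plugRep {t a b : Fin 4} (h : 0 < plugLabel t a b) :
    ∃ c, EdgeRel plugGlue (t, a, b) (plugRep c) := by
  obtain ⟨c, k, hwalk⟩ := exists_edgeWalk_plugRep t a b h
  exact ⟨c, hwalk ▸ (edgeRel_edgeWalk plugGlue _ (plugRep_ne c)).symm⟩

theorem plugLabel_swap : ∀ t a b : Fin 4, plugLabel t b a = -plugLabel t a b := by decide

theorem plugLabel_ne_zero : ∀ t a b : Fin 4, a ≠ b → plugLabel t a b ≠ 0 := by decide

/-- The edges of the plug, distinguished by `plugLabel`. -/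
def plugLabelling : EdgeLabelling plug.glue (Fin 6) where
  label := plugLabel
  ne_zero := plugLabel_ne_zero
  swap t a b _ := plugLabel_swap t a b
  step t f u σ h := (plugGlue_spec t f (u, σ) h).2.2
  rep := plugRep
  rep_ne := plugRep_ne
  rep_injective := by
    intro c c' h
    simp only [plugLabel_plugRep] at h
    omega
  exists_rep := by
    intro t a b hab
    rcases lt_or_gt_of_ne (plugLabel_ne_zero t a b hab) with h | h
    · rw [← neg_pos, ← plugLabel_swap] at h
      exact (exists_plugRep h).imp fun _ => .inr
    · exact (exists_plugRep h).imp fun _ => .inl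

theorem plug_isOneVertex : plug.IsOneVertex := by
  have hedge : ∀ {t t' a b a' b' : Fin 4}, a ≠ b → a' ≠ b' →
      plugLabel t a b = plugLabel t' a' b' → plug.VertexRel (t, a) (t', a') :=
    plugLabelling.vertexRel
  have h2 : plug.VertexRel (0, 2) (0, 0) := hedge (b := 3) (b' := 1) (by decide) (by decide) rfl
  have h1 : plug.VertexRel (0, 1) (0, 0) := hedge (b := 3) (b' := 2) (by decide) (by decide) rfl
  have h3 : plug.VertexRel (0, 3) (0, 0) :=
    (hedge (b := 2) (b' := 0) (by decide) (by decide) rfl).trans h1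
  have hzero : ∀ v, plug.VertexRel (0, v) (0, 0) := by
    intro v
    fin_cases v
    exacts [.refl _, h1, h2, h3]
  have hlabel : ∀ t a : Fin 4, ∃ b a' b',
      a ≠ b ∧ a' ≠ b' ∧ plugLabel t a b = plugLabel 0 a' b' := by
    decide
  refine Triangulation.isOneVertex_of_vertexRel (0, 0) fun ⟨t, a⟩ => ?_
  obtain ⟨b, a', b', hab, hab', h⟩ := hlabel t a
  exact (hedge hab hab' h).trans (hzero a')

/-! ### The closed triangulations -/

/-- `(013) ↦ (213)` -/
def capPerm₂ : Equiv.Perm (Fin 4) := mkPerm ![2, 1, 0, 3] ![2, 1, 0, 3]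

/-- `(012) ↦ (301)` -/
def capPerm₃ : Equiv.Perm (Fin 4) := mkPerm ![3, 0, 1, 2] ![1, 2, 3, 0]

/-- The gluings `m(013) ↦ 3(213)` and `m(012) ↦ 3(301)` of the boundary of the layered solid torus
to the boundary of the plug. -/
def capPairing (m : ℕ) : BoundaryPairing (layeredSolidTorus (m + 1)) plug where
  toRight _ f := (3, if f = 2 then capPerm₂ else capPerm₃)
  toLeft _ f := (Fin.last m, if f = 0 then capPerm₂.symm else capPerm₃.symm)
  toRight_spec t f h := by
    obtain ⟨rfl, rfl | rfl⟩ := layeredGlue_eq_none.1 h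
    · exact ⟨rfl, rfl⟩
    · exact ⟨rfl, rfl⟩
  toLeft_spec u f h := by
    obtain ⟨rfl, rfl | rfl⟩ := plugGlue_eq_none.1 h
    · exact ⟨layeredGlue_eq_none.2 ⟨rfl, .inl rfl⟩, rfl⟩
    · exact ⟨layeredGlue_eq_none.2 ⟨rfl, .inr rfl⟩, rfl⟩

theorem renumber_layeredLabel_last (m : ℕ) (a b : Fin 4) :
    renumber m ((-1) ^ m * layeredLabel m a b) =
      layeredLabel m a b - (m + 8) * (layeredLabel m a b).sign := by
  have hsq : ((-1 : ℤ) ^ m) * (-1) ^ m = 1 := by rw [← mul_pow]; simp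
  have hsign : ((-1 : ℤ) ^ m).sign = (-1) ^ m := by
    rcases neg_one_pow_eq_or ℤ m with h | h <;> rw [h] <;> rfl
  rw [renumber, Int.sign_mul, hsign]
  linear_combination (layeredLabel m a b - (m + 8) * (layeredLabel m a b).sign) * hsq

theorem capPairing_compatible (m : ℕ) :
    (capPairing m).Compatible (layeredLabelling m) plugLabelling := by
  intro t f h a b hab ha hb
  obtain ⟨rfl, hf⟩ := layeredGlue_eq_none.1 h
  refine Eq.trans ?_ (renumber_layeredLabel_last m a b).symm
  have hsign : ∀ j : ℤ, 0 < j → (m + j).sign = 1 := fun j hj =>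
    Int.sign_eq_one_of_pos (by positivity)
  have hsign' : ∀ j : ℤ, 0 < j → (-j + -m).sign = -1 := fun j hj =>
    Int.sign_eq_neg_one_of_neg (by omega)
  rcases hf with rfl | rfl <;> fin_cases a <;> fin_cases b <;>
    simp [capPairing, plugLabelling, plugLabel, layeredLabel, capPerm₂, capPerm₃, mkPerm, hsign,
      hsign'] at hab ha hb ⊢

/-- The closed triangulation obtained by closing the layered solid torus with `m + 1` tetrahedra
by the plug. -/
def capped (m : ℕ) : Triangulation (Fin (m + 1 + 4)) :=
  BoundaryPairing.union finSumFinEquiv (capPairing_compatible m)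

theorem isBoundaryUnion_capped (m : ℕ) :
    (layeredSolidTorus (m + 1)).IsBoundaryUnion plug (capped m) :=
  BoundaryPairing.isBoundaryUnion_union _ _

theorem coversInterior_castLE :
    BoundaryPairing.CoversInterior plugLabelling (Fin.castLEEmb (by decide : 3 ≤ 6)) := by
  intro c hc
  have hboundary : ∀ c : Fin 6, 3 ≤ c → (plugRep c).1 = 3 ∧ (plugRep c).2.1 ≠ 0 ∧
      (plugRep c).2.2 ≠ 0 := by decide
  have hc' : 3 ≤ c := by
    by_contra! hlt
    exact hc ⟨⟨c, hlt⟩, rfl⟩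
  obtain ⟨ht, ha, hb⟩ := hboundary c hc'
  exact ⟨3, 0, rfl, (plugRep c).2.1, (plugRep c).2.2, plugRep_ne c, ha, hb, ht ▸ .refl _⟩

theorem natAbs_plugLabel_plugRep (c : Fin 6) :
    (plugLabel (plugRep c).1 (plugRep c).2.1 (plugRep c).2.2).natAbs = c + 1 := by
  rw [plugLabel_plugRep]
  omega

/-- The edges of the closed triangulation: those of the layered solid torus and the three interior
edges of the plug. -/
def cappedLabelling (m : ℕ) :
    EdgeLabelling (capped m).glue ((Fin 2 ⊕ Fin (m + 1)) ⊕ Fin 3) :=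
  BoundaryPairing.unionLabelling finSumFinEquiv (capPairing_compatible m)
    coversInterior_castLE <| by
    intro c c' h
    have hle := (layeredRep m c).1.is_le
    have hlayered := natAbs_layeredLabel (layeredRep m c).1 (layeredRep_ne m c)
    have hrenumber := natAbs_renumber_layeredLabel hle (layeredRep_ne m c)
    have hplug := natAbs_plugLabel_plugRep (c'.castLE (by decide))
    have heq := (hrenumber.symm.trans h).trans hplug
    rw [Fin.val_castLE] at heq
    omega

theorem capped_isOneVertex (m : ℕ) : (capped m).IsOneVertex :=
  (isBoundaryUnion_capped m).isOneVertex (layeredSolidTorus_isOneVertex m) plug_isOneVertex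
    fun h => h (Fin.last m) 2 ((layeredGlue_eq_none (m := m)).2 ⟨rfl, .inl rfl⟩)

theorem capped_isClosedManifold (m : ℕ) : (capped m).IsClosedManifold :=
  (capped_isOneVertex m).isClosedManifold (isBoundaryUnion_capped m).isClosed (cappedLabelling m)
    (by simp; ring)

/-! ### The surfaces in the closed triangulations -/

section Coordinates

variable {R : Type*} [CommSemiring R]

/-- The coordinates of `c` copies of the meridian disc of the layered solid torus in its
tetrahedron `k`. -/
def meridianDiscs (c : R) (k : ℕ) : Disc → R :=
  Sum.elim ![c * Nat.fib (k + 2), c * Nat.fib (k + 2), 0, 0] ![0, c * Nat.fib (k + 1), 0]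

/-- The coordinates of the part of the surface in the plug; they satisfy the matching equations
if `r = 2 * p + q`. -/
def plugCoord (p q r : R) : Fin 4 → Disc → R :=
  ![Sum.elim ![p, 0, 0, p] ![0, r, 0], Sum.elim ![p, 0, r, 0] ![0, 0, p],
    Sum.elim ![p, 0, 0, r] ![0, p, 0], Sum.elim ![2 * p, 0, 2 * p, 0] ![q, 0, 0]]

/-- The surface in the closed triangulation that consists of `c` meridian discs of the layered
solid torus and a surface in the plug; the two parts fit together if
`2 * p = c * Nat.fib (m + 3)`. -/
def cappedSurface (m : ℕ) (c p : R) : Fin (m + 1 + 4) → Disc → R := fun t =>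
  Sum.elim (fun k : Fin (m + 1) => meridianDiscs c k)
    (plugCoord p (c * Nat.fib (m + 2)) (c * Nat.fib (m + 4))) (finSumFinEquiv.symm t)

theorem cappedSurface_inl (m : ℕ) (c p : R) (k : Fin (m + 1)) :
    cappedSurface m c p (finSumFinEquiv (.inl k)) = meridianDiscs c k := by
  rw [cappedSurface, Equiv.symm_apply_apply, Sum.elim_inl]

theorem cappedSurface_inr (m : ℕ) (c p : R) (j : Fin 4) :
    cappedSurface m c p (finSumFinEquiv (.inr j)) =
      plugCoord p (c * Nat.fib (m + 2)) (c * Nat.fib (m + 4)) j := by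
  rw [cappedSurface, Equiv.symm_apply_apply, Sum.elim_inr]

theorem mul_fib_add_two (c : R) (k : ℕ) :
    c * Nat.fib (k + 2) = c * Nat.fib k + c * Nat.fib (k + 1) := by
  rw [Nat.fib_add_two, Nat.cast_add, mul_add]

theorem matching_meridianDiscs (n : ℕ) (c : R) :
    (layeredSolidTorus n).Matching fun k => meridianDiscs c k := by
  intro t f u σ hg v hv
  have hfib := mul_fib_add_two c
  rcases (layeredGlue_eq_some n t f u σ).1 hg with ⟨rfl, h, h', rfl⟩ | ⟨rfl, h, h', rfl⟩ |
    ⟨rfl, h, rfl⟩ | ⟨rfl, h, rfl⟩ | ⟨rfl, h, rfl⟩ | ⟨rfl, h, rfl⟩ <;>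
  fin_cases v <;>
  simp [*, foldPerm, layerPerm₀, layerPerm₁, mkPerm, arcCount, meridianDiscs, quadOf] at hv ⊢ <;>
  grind

theorem matching_plugCoord (p q : R) : plug.Matching (plugCoord p q (2 * p + q)) := by
  intro t f u σ hg v hv
  replace hg : plugGlue t f = some (u, σ) := hg
  fin_cases t <;> fin_cases f <;> cases hg <;> fin_cases v <;>
    simp [plugPerm₁, plugPerm₂, mkPerm, arcCount, plugCoord, quadOf] at hv ⊢ <;> ring

theorem matching_cap_iff {m : ℕ} {c p q r : R} :
    (∀ t f, (layeredSolidTorus (m + 1)).glue t f = none → ∀ v, v ≠ f →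
      arcCount (meridianDiscs c t) f v = arcCount
        (plugCoord p q r ((capPairing m).toRight t f).1)
        (((capPairing m).toRight t f).2 f) (((capPairing m).toRight t f).2 v)) ↔
      2 * p = c * Nat.fib (m + 3) ∧ q = c * Nat.fib (m + 2) := by
  have hfib := mul_fib_add_two c (m + 1)
  constructor
  · intro h
    have h₂ := h (Fin.last m) 2 ((layeredGlue_eq_none (m := m)).2 ⟨rfl, .inl rfl⟩)
    have h0 : c * Nat.fib (m + 2) + c * Nat.fib (m + 1) = 2 * p := by
      simpa [arcCount, quadOf, capPairing, capPerm₂, mkPerm, meridianDiscs, plugCoord] using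
        h₂ 0 (by decide)
    have h1 : c * Nat.fib (m + 2) = q := by
      simpa [arcCount, quadOf, capPairing, capPerm₂, mkPerm, meridianDiscs, plugCoord] using
        h₂ 1 (by decide)
    exact ⟨by rw [← h0, hfib, add_comm], h1.symm⟩
  · rintro ⟨hp, rfl⟩ t f h v hv
    obtain ⟨rfl, rfl | rfl⟩ := layeredGlue_eq_none.1 h <;> fin_cases v <;>
      simp [arcCount, quadOf, capPairing, capPerm₂, capPerm₃, mkPerm, meridianDiscs, plugCoord]
        at hv ⊢ <;> grind

theorem matching_cappedSurface {m : ℕ} {c p : R} (h : 2 * p = c * Nat.fib (m + 3)) :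
    (capped m).Matching (cappedSurface m c p) := by
  have hr : c * Nat.fib (m + 4) = 2 * p + c * Nat.fib (m + 2) := by
    rw [mul_fib_add_two, h, add_comm]
  rw [capped, BoundaryPairing.matching_union_iff]
  simp only [cappedSurface_inl, cappedSurface_inr, hr]
  exact ⟨matching_meridianDiscs _ c, matching_plugCoord p _, matching_cap_iff.2 ⟨h, rfl⟩⟩

end Coordinates

theorem isNormal_cappedSurface {m s p : ℕ} (h : 2 * p = s * Nat.fib (m + 3)) :
    (capped m).IsNormal (cappedSurface m s p) := by
  refine ⟨matching_cappedSurface h, fun t q q' hq hq' => ?_⟩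
  obtain ⟨k | j, rfl⟩ := finSumFinEquiv.surjective t
  · rw [cappedSurface_inl] at hq hq'
    fin_cases q <;> fin_cases q' <;> simp [meridianDiscs] at hq hq' ⊢
  · rw [cappedSurface_inr] at hq hq'
    fin_cases j <;> fin_cases q <;> fin_cases q' <;> simp [plugCoord] at hq hq' ⊢

/-! ### Extremality -/

section Solutions

variable {R : Type*} [CommRing R]

theorem eq_meridianDiscs_of_matching {m c : ℕ} {y : Fin (m + 1) → Disc → R}
    (hy : (layeredSolidTorus (m + 1)).Matching y)
    (h0 : ∀ (k : Fin (m + 1)) d, meridianDiscs c k d = 0 → y k d = 0) (k : Fin (m + 1)) :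
    y k = meridianDiscs (y 0 (.inr 1)) k := by
  have hsupp : ∀ k, y k (.inl 2) = 0 ∧ y k (.inl 3) = 0 ∧ y k (.inr 0) = 0 ∧ y k (.inr 2) = 0 :=
    fun k => ⟨h0 k _ rfl, h0 k _ rfl, h0 k _ rfl, h0 k _ rfl⟩
  suffices h : y k (.inl 0) = y 0 (.inr 1) * Nat.fib (k + 2) ∧
      y k (.inl 1) = y 0 (.inr 1) * Nat.fib (k + 2) ∧
      y k (.inr 1) = y 0 (.inr 1) * Nat.fib (k + 1) by
    ext (d | d) <;> fin_cases d <;> simp [meridianDiscs, h, hsupp]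
  induction k using Fin.induction with
  | zero =>
    have hfold := hy 0 1 _ _ (layeredGlue_zero m)
    have e₀ := hfold 0 (by decide)
    have e₃ := hfold 3 (by decide)
    simp [arcCount, quadOf, foldPerm, mkPerm, hsupp] at e₀ e₃
    simp [e₀, ← e₃]
  | succ k ih =>
    have e₁ := hy k.succ 0 _ _ (layeredGlue_succ_zero k) 1 (by decide)
    have e₂ := hy k.succ 0 _ _ (layeredGlue_succ_zero k) 2 (by decide)
    have e₀ := hy k.succ 1 _ _ (layeredGlue_succ_one k) 0 (by decide)
    simp [arcCount, quadOf, layerPerm₀, layerPerm₁, mkPerm, hsupp, ih, ← mul_add,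
      ← Nat.cast_add] at e₀ e₁ e₂
    have hfib : Nat.fib (k + 3) = Nat.fib (k + 2) + Nat.fib (k + 1) := by
      rw [Nat.fib_add_two, add_comm]
    simp [e₀, e₁, e₂, hfib, add_right_comm _ 1]

theorem eq_plugCoord_of_matching {p q r : ℕ} {y : Fin 4 → Disc → R} (hy : plug.Matching y)
    (h0 : ∀ j d, plugCoord p q r j d = 0 → y j d = 0) :
    y = plugCoord (y 0 (.inl 0)) (y 3 (.inr 0)) (2 * y 0 (.inl 0) + y 3 (.inr 0)) := by
  have hsupp : (y 0 (.inl 1) = 0 ∧ y 0 (.inl 2) = 0 ∧ y 0 (.inr 0) = 0 ∧ y 0 (.inr 2) = 0) ∧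
      (y 1 (.inl 1) = 0 ∧ y 1 (.inl 3) = 0 ∧ y 1 (.inr 0) = 0 ∧ y 1 (.inr 1) = 0) ∧
      (y 2 (.inl 1) = 0 ∧ y 2 (.inl 2) = 0 ∧ y 2 (.inr 0) = 0 ∧ y 2 (.inr 2) = 0) ∧
      (y 3 (.inl 1) = 0 ∧ y 3 (.inl 3) = 0 ∧ y 3 (.inr 1) = 0 ∧ y 3 (.inr 2) = 0) := by
    refine ⟨⟨?_, ?_, ?_, ?_⟩, ⟨?_, ?_, ?_, ?_⟩, ⟨?_, ?_, ?_, ?_⟩, ?_, ?_, ?_, ?_⟩ <;>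
      exact h0 _ _ rfl
  have a₂ := hy 0 0 _ _ rfl 2 (by decide)
  have a₃ := hy 0 0 _ _ rfl 3 (by decide)
  have b₀ := hy 0 1 _ _ rfl 0 (by decide)
  have b₃ := hy 0 1 _ _ rfl 3 (by decide)
  have c₀ := hy 0 2 _ _ rfl 0 (by decide)
  have g₀ := hy 1 2 _ _ rfl 0 (by decide)
  have d₀ := hy 1 3 _ _ rfl 0 (by decide)
  have d₂ := hy 1 3 _ _ rfl 2 (by decide)
  have f₀ := hy 2 2 _ _ rfl 0 (by decide)
  have f₃ := hy 2 2 _ _ rfl 3 (by decide)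
  simp [arcCount, quadOf, plugPerm₁, plugPerm₂, mkPerm, hsupp] at a₂ a₃ b₀ b₃ c₀ g₀ d₀ d₂ f₀ f₃
  ext j (d | d) <;> fin_cases j <;> fin_cases d <;> simp [plugCoord, hsupp] <;> grind

theorem exists_eq_cappedSurface {m s p : ℕ} {y : Fin (m + 1 + 4) → Disc → R}
    (hy : (capped m).Matching y)
    (h0 : ∀ t d, cappedSurface m s p t d = 0 → y t d = 0) :
    ∃ c a : R, 2 * a = c * Nat.fib (m + 3) ∧ y = cappedSurface m c a := by
  obtain ⟨hlayered, hplug, hcap⟩ := (BoundaryPairing.matching_union_iff _ _).1 hy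
  have hleft := eq_meridianDiscs_of_matching hlayered fun k d hd =>
    h0 _ d (by rw [cappedSurface_inl, hd])
  have hright := eq_plugCoord_of_matching hplug fun j d hd =>
    h0 _ d (by rw [cappedSurface_inr, hd])
  generalize y (finSumFinEquiv (.inl 0)) (.inr 1) = c at hleft
  generalize y (finSumFinEquiv (.inr 0)) (.inl 0) = a at hright
  generalize y (finSumFinEquiv (.inr 3)) (.inr 0) = q at hright
  simp only [hleft, congrFun hright] at hcap
  obtain ⟨ha, rfl⟩ := matching_cap_iff.1 hcap
  have hr : c * Nat.fib (m + 4) = 2 * a + c * Nat.fib (m + 2) := by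
    rw [mul_fib_add_two, ha, add_comm]
  refine ⟨c, a, ha, ?_⟩
  ext t : 1
  obtain ⟨k | j, rfl⟩ := finSumFinEquiv.surjective t
  · rw [cappedSurface_inl, hleft]
  · rw [cappedSurface_inr, congrFun hright, hr]

end Solutions

theorem mem_ray_cappedSurface {m s p : ℕ} (hs : s ≠ 0) (h : 2 * p = s * Nat.fib (m + 3))
    {y : Fin (m + 1 + 4) → Disc → ℝ} (hy : y ∈ (capped m).solutionCone)
    (h0 : ∀ t d, cappedSurface m s p t d = 0 → y t d = 0) :
    y ∈ Triangulation.ray (Triangulation.toReal (cappedSurface m s p)) := by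
  obtain ⟨c, a, ha, rfl⟩ := exists_eq_cappedSurface hy.2 h0
  have hs' : (s : ℝ) ≠ 0 := Nat.cast_ne_zero.2 hs
  have hc : 0 ≤ c := by
    have h := hy.1 (finSumFinEquiv (.inl 0)) (.inl 0)
    rw [cappedSurface_inl] at h
    simpa [meridianDiscs] using h
  have hcs : c = c / s * s := (div_mul_cancel₀ c hs').symm
  have hap : a = c / s * p := by
    have h' : (2 : ℝ) * p = s * Nat.fib (m + 3) := by exact_mod_cast h
    linear_combination (ha - c / s * h' + Nat.fib (m + 3) * hcs) / 2
  refine ⟨c / s, by positivity, ?_⟩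
  ext t d
  rw [Pi.smul_apply, Pi.smul_apply, smul_eq_mul, Triangulation.toReal]
  generalize c / s = l at hcs hap
  subst hcs hap
  obtain ⟨k | j, rfl⟩ := finSumFinEquiv.surjective t
  · simp only [cappedSurface_inl]
    rcases d with d | d <;> fin_cases d <;> simp [meridianDiscs, mul_assoc]
  · simp only [cappedSurface_inr]
    rcases d with d | d <;> fin_cases j <;> fin_cases d <;>
      simp [plugCoord, mul_assoc, mul_left_comm]

theorem isVertexNormal_cappedSurface {m s p : ℕ} (hs : s ≠ 0) (h : 2 * p = s * Nat.fib (m + 3))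
    (hsp : Nat.Coprime s p) : (capped m).IsVertexNormal (cappedSurface m s p) := by
  have hco : Nat.Coprime (cappedSurface m s p (finSumFinEquiv (.inl 0)) (.inl 0))
      (cappedSurface m s p (finSumFinEquiv (.inr 0)) (.inl 0)) := by
    rw [cappedSurface_inl, cappedSurface_inr]
    simpa [meridianDiscs, plugCoord] using hsp
  exact (isNormal_cappedSurface h).isVertexNormal hco fun y => mem_ray_cappedSurface hs h

/-! ### The Euler characteristic of the surfaces -/

theorem sum_range_fib_add (n j : ℕ) :
    (∑ k ∈ Finset.range n, Nat.fib (k + j)) + Nat.fib (j + 1) = Nat.fib (n + j + 1) := by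
  induction n with
  | zero => simp
  | succ n ih =>
    rw [Finset.sum_range_succ, add_right_comm, ih, show n + 1 + j + 1 = n + j + 2 by ring,
      Nat.fib_add_two, add_comm]

theorem sum_edgeWeight_layeredRep (m s : ℕ) :
    (∑ c, edgeWeight (meridianDiscs s (layeredRep m c).1) (layeredRep m c).2.1
      (layeredRep m c).2.2) + 2 * s = s * Nat.fib (m + 6) := by
  have hbase : edgeWeight (meridianDiscs s 0) 0 2 + edgeWeight (meridianDiscs s 0) 0 3 = 3 * s := by
    simp [edgeWeight, meridianDiscs, quadOf, Finset.sum_filter, Fin.sum_univ_three]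
    ring
  have hstep : ∀ k, edgeWeight (meridianDiscs s k) 0 1 = s * Nat.fib (k + 4) := by
    intro k
    have h₄ : s * Nat.fib (k + 4) = s * Nat.fib (k + 2) + s * Nat.fib (k + 3) :=
      mul_fib_add_two s (k + 2)
    have h₃ : s * Nat.fib (k + 3) = s * Nat.fib (k + 1) + s * Nat.fib (k + 2) :=
      mul_fib_add_two s (k + 1)
    simp [edgeWeight, meridianDiscs, quadOf, Finset.sum_filter, Fin.sum_univ_three]
    omega
  calc _ = 3 * s + ∑ k : Fin (m + 1), s * Nat.fib (k + 4) + 2 * s := by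
        simp [layeredRep, hbase, hstep]
    _ = s * ((∑ k ∈ Finset.range (m + 1), Nat.fib (k + 4)) + Nat.fib 5) := by
        rw [Fin.sum_univ_eq_sum_range fun k => s * Nat.fib (k + 4), ← Finset.mul_sum,
          show Nat.fib 5 = 5 from rfl]
        ring
    _ = s * Nat.fib (m + 6) := by rw [sum_range_fib_add, show m + 1 + 4 + 1 = m + 6 by ring]

theorem sum_meridianDiscs (m s : ℕ) :
    (∑ k : Fin (m + 1), ((∑ v, meridianDiscs s k (.inl v)) +
      2 * ∑ q, meridianDiscs s k (.inr q))) + 6 * s = 2 * (s * Nat.fib (m + 5)) := by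
  have hterm : ∀ k, (∑ v, meridianDiscs s k (.inl v)) + 2 * ∑ q, meridianDiscs s k (.inr q) =
      2 * s * Nat.fib (k + 3) := by
    intro k
    simp [meridianDiscs, Fin.sum_univ_four, Fin.sum_univ_three, Nat.fib_add_two (n := k + 1)]
    ring
  calc _ = ∑ k : Fin (m + 1), 2 * s * Nat.fib (k + 3) + 6 * s := by simp only [hterm]
    _ = 2 * s * ((∑ k ∈ Finset.range (m + 1), Nat.fib (k + 3)) + Nat.fib 4) := by
        rw [Fin.sum_univ_eq_sum_range fun k => 2 * s * Nat.fib (k + 3), ← Finset.mul_sum,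
          show Nat.fib 4 = 3 from rfl]
        ring
    _ = 2 * (s * Nat.fib (m + 5)) := by
        rw [sum_range_fib_add, show m + 1 + 3 + 1 = m + 5 by ring, mul_assoc]

theorem sum_edgeWeight_plugRep (p q r : ℕ) :
    ∑ c : Fin 3, edgeWeight (plugCoord p q r (plugRep (c.castLE (by decide))).1)
      (plugRep (c.castLE (by decide))).2.1 (plugRep (c.castLE (by decide))).2.2 =
      6 * p + q + r := by
  simp [Fin.sum_univ_three, plugRep, edgeWeight, plugCoord, quadOf, Finset.sum_filter]
  ring

theorem sum_plugCoord (p q r : ℕ) :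
    ∑ j, ((∑ v, plugCoord p q r j (.inl v)) + 2 * ∑ d, plugCoord p q r j (.inr d)) =
      12 * p + 2 * q + 4 * r := by
  simp [plugCoord, Fin.sum_univ_four, Fin.sum_univ_three]
  ring

theorem eulerChar_cappedSurface {m s p : ℕ} (h : 2 * p = s * Nat.fib (m + 3)) :
    (capped m).eulerChar (cappedSurface m s p) = s := by
  have hχ := (cappedLabelling m).two_mul_eulerChar (isBoundaryUnion_capped m).isClosed
    (matching_cappedSurface h)
  have hweight : ∑ c, edgeWeight (cappedSurface m s p ((cappedLabelling m).rep c).1)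
      ((cappedLabelling m).rep c).2.1 ((cappedLabelling m).rep c).2.2 + 2 * s =
      s * Nat.fib (m + 6) + (6 * p + s * Nat.fib (m + 2) + s * Nat.fib (m + 4)) := by
    rw [← sum_edgeWeight_layeredRep, ← sum_edgeWeight_plugRep, add_right_comm _ (2 * s),
      Fintype.sum_sum_type]
    simp only [cappedLabelling, BoundaryPairing.unionLabelling, BoundaryPairing.unionRep,
      Sum.elim_inl, Sum.elim_inr, cappedSurface_inl, cappedSurface_inr]
    rfl
  have hdiscs : (∑ t, ((∑ v, cappedSurface m s p t (.inl v)) +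
      2 * ∑ d, cappedSurface m s p t (.inr d))) + 6 * s = 2 * (s * Nat.fib (m + 5)) +
      (12 * p + 2 * (s * Nat.fib (m + 2)) + 4 * (s * Nat.fib (m + 4))) := by
    rw [← sum_meridianDiscs, ← sum_plugCoord, add_right_comm _ (6 * s), ← finSumFinEquiv.sum_comp,
      Fintype.sum_sum_type]
    simp only [cappedSurface_inl, cappedSurface_inr]
    rfl
  have h₆ : s * Nat.fib (m + 6) = s * Nat.fib (m + 4) + s * Nat.fib (m + 5) :=
    mul_fib_add_two s (m + 4)
  omega

theorem le_maxCoord_cappedSurface (m s p : ℕ) :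
    s * Nat.fib (m + 2) ≤ Triangulation.maxCoord (cappedSurface m s p) := by
  have := Finset.le_sup (f := fun q : Fin (m + 1 + 4) × Disc => cappedSurface m s p q.1 q.2)
    (Finset.mem_univ (finSumFinEquiv (.inl (Fin.last m)), .inl 0))
  rwa [cappedSurface_inl] at this

theorem coprime_two_fib {n : ℕ} (hn : ¬ 3 ∣ n) : Nat.Coprime 2 (Nat.fib n) := by
  have h := Nat.fib_gcd 3 n
  rw [((Nat.prime_three.coprime_iff_not_dvd).2 hn).gcd_eq_one] at h
  exact h.symm

/-- The triangulation by `n` disjoint tetrahedra; it fills the irrelevant small values of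
`cappedFamily`. -/
def unglued (n : ℕ) : Triangulation (Fin n) where
  glue _ _ := none
  glue_symm _ _ _ _ h := nomatch h
  glue_ne _ _ _ _ h := nomatch h
  no_reverse := no_reverse_of_label _ (fun _ a b => (a : ℤ) - b)
    (fun _ a b hab => ⟨by rw [Ne, sub_eq_zero]; exact_mod_cast Fin.val_injective.ne hab, by ring⟩)
    (fun _ _ _ _ h => nomatch h)

/-- The family of closed triangulations, indexed by the number of tetrahedra. -/
def cappedFamily : (n : ℕ) → Triangulation (Fin n)
  | m + 5 => capped m
  | n => unglued n

end NormalSurf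

theorem theorem6 :
    ∃ C : (n : ℕ) → NormalSurf.Triangulation (Fin n), ∀ n : ℕ, 5 ≤ n →
      NormalSurf.Triangulation.IsBoundaryUnion
        (NormalSurf.layeredSolidTorus (n - 4)) NormalSurf.plug (C n) ∧
      (C n).IsClosed ∧ (C n).IsOneVertex ∧ (C n).IsClosedManifold ∧
      ∃ x : Fin n → NormalSurf.Disc → ℕ, (C n).IsVertexNormal x ∧
        (n % 3 = 2 → (C n).IsProjectivePlane x ∧
          Nat.fib (n - 3) ≤ NormalSurf.Triangulation.maxCoord x) ∧
        (n % 3 ≠ 2 → (C n).IsSphere x ∧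
          2 * Nat.fib (n - 3) ≤ NormalSurf.Triangulation.maxCoord x) := by
  open NormalSurf in
  refine ⟨cappedFamily, fun n hn => ?_⟩
  obtain ⟨m, rfl⟩ := Nat.exists_eq_add_of_le' hn
  have hclosed := (isBoundaryUnion_capped m).isClosed
  refine ⟨isBoundaryUnion_capped m, hclosed, capped_isOneVertex m, capped_isClosedManifold m, ?_⟩
  by_cases h3 : (m + 5) % 3 = 2
  · obtain ⟨p, hp⟩ : 2 ∣ Nat.fib (m + 3) := Nat.fib_dvd 3 (m + 3) (by omega)
    have h : 2 * p = 1 * Nat.fib (m + 3) := by rw [one_mul, hp]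
    have hv := isVertexNormal_cappedSurface one_ne_zero h (Nat.coprime_one_left p)
    have hmax := le_maxCoord_cappedSurface m 1 p
    rw [one_mul] at hmax
    exact ⟨_, hv, fun _ => ⟨⟨hv.isClosedConnectedSurface hclosed, eulerChar_cappedSurface h⟩,
      hmax⟩, fun hn3 => absurd h3 hn3⟩
  · have hv := isVertexNormal_cappedSurface two_ne_zero (rfl : 2 * Nat.fib (m + 3) = _)
      (coprime_two_fib (by omega))
    exact ⟨_, hv, fun hn3 => absurd hn3 h3, fun _ =>
      ⟨⟨hv.isClosedConnectedSurface hclosed, eulerChar_cappedSurface rfl⟩,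
      le_maxCoord_cappedSurface m 2 _⟩⟩
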